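/- Let $\alpha>-1$, $\omega_\alpha(x)=x^\alpha e^{-x}$ and $\gamma_k^{(\alpha)}=\Gamma(k+\alpha+1)/k!$, and let $L_k^{(\alpha)}(x)=\frac{(\alpha+1)_k}{k!}M(-k,\alpha+1;x)$ be the generalized Laguerre polynomial, where $M(a,c;x)=\sum_{j\ge0}\frac{(a)_j}{(c)_j}\frac{x^j}{j!}$ and $(a)_j=a(a+1)\cdots(a+j-1)$. For $z\in\mathbb C\setminus[0,\infty)$ put $$\Phi_k^{(\alpha)}(z)=\frac1{2\pi i}\int_0^\infty\frac{\omega_\alpha(x)L_k^{(\alpha)}(x)}{z-x}\,dx .$$ Let $\rho>0$, $P_\rho=\{z\in\mathbb C:\operatorname{Re}\sqrt{-z}=\rho\}$ (a parabola with vertex $-\rho^2$ and focus $0$, opening to the right) and $D_\rho=\{z\in\mathbb C:\operatorname{Re}\sqrt{-z}<\rho\}$, where $\sqrt{-z}$ has its branch cut along the positive real axis and is positive for $z<0$ (on the cut, $\operatorname{Re}\sqrt{-z}=0$). **Theorem.** Let $f$ be analytic in a neighbourhood of every point of $D_\rho\cup P_\rho$, and suppose that for some real $\mathcal K$ and $\beta$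 we have $|f(z)|\le\mathcal K|z|^\beta$ for all $z\in D_\rho$ of sufficiently large modulus. Then for every integer $k\ge\max\{\lfloor\beta-\tfrac12\rfloor+1,0\}$ the Laguerre coefficient $$a_k^{(\alpha)}=\frac1{\gamma_k^{(\alpha)}}\int_0^\infty f(x)L_k^{(\alpha)}(x)\,\omega_\alpha(x)\,dx$$ is given by an absolutely convergent integral, and $$a_k^{(\alpha)}=\frac1{\gamma_k^{(\alpha)}}\int_{P_\rho}\Phi_k^{(\alpha)}(z)f(z)\,dz .$$ Here $P_\rho$ is oriented counterclockwise (from infinity in the upper half plane, through $-\rho^2$, to infinity in the lower half plane), and the integral over $P_\rho$ is the limit, as $\eta\to\infty$, of the integrals over the part of $P_\rho$ with $\operatorname{Re}z\le\eta$; this limit exists, and if $k>\beta$ the integral over $P_\rho$ also converges absolutely. -/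

import Mathlib

open Filter Topology MeasureTheory Set

namespace LaguerreParabola

noncomputable section

/-- The Pochhammer symbol `(a)_k = a (a + 1) ⋯ (a + k - 1)`. -/
def poch (a : ℝ) (k : ℕ) : ℝ := (ascPochhammer ℝ k).eval a

/-- Kummer's confluent hypergeometric function `M(a, c; x)` on the reals. -/
def kummerM (a c x : ℝ) : ℝ :=
  ∑' j : ℕ, poch a j / poch c j * (x ^ j / (j.factorial : ℝ))

/-- The generalized Laguerre polynomial `L_k^{(α)}`. -/
def laguerreL (α : ℝ) (k : ℕ) (x : ℝ) : ℝ :=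
  poch (α + 1) k / (k.factorial : ℝ) * kummerM (-(k : ℝ)) (α + 1) x

/-- The weight `ω_α(x) = x^α e^{-x}`. -/
def weight (α x : ℝ) : ℝ := x ^ α * Real.exp (-x)

/-- The squared weighted norm `γ_k^{(α)} = Γ(k + α + 1) / k!` of `L_k^{(α)}`. -/
def gammaCoeff (α : ℝ) (k : ℕ) : ℝ := Real.Gamma (k + α + 1) / (k.factorial : ℝ)

/-- The integrand `f(x) L_k^{(α)}(x) ω_α(x)` of the weighted inner product. -/
def coeffIntegrand (α : ℝ) (k : ℕ) (f : ℂ → ℂ) (x : ℝ) : ℂ :=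
  f (x : ℂ) * (laguerreL α k x : ℂ) * (weight α x : ℂ)

/-- The Laguerre coefficient `a_k^{(α)} = ⟨f, L_k^{(α)}⟩ / γ_k^{(α)}` (the inner product is
bilinear, without conjugation). -/
def laguerreCoeff (α : ℝ) (k : ℕ) (f : ℂ → ℂ) : ℂ :=
  (∫ x in Ici (0 : ℝ), coeffIntegrand α k f x) / (gammaCoeff α k : ℂ)

/-- The weighted Cauchy transform `Φ_k^{(α)}(z)`, meant for `z` outside `[0, ∞)`. -/
def cauchyPhi (α : ℝ) (k : ℕ) (z : ℂ) : ℂ :=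
  1 / (2 * (Real.pi : ℂ) * Complex.I) *
    ∫ x in Ici (0 : ℝ), ((weight α x * laguerreL α k x : ℝ) : ℂ) / (z - (x : ℂ))

/-- `√(-z)`, with branch cut along the positive real axis and positive for `z < 0`. On the cut
its real part is `0`. -/
def sqrtNeg (z : ℂ) : ℂ := Complex.sqrt (-z)

/-- The parabola `P_ρ`. -/
def parabola (ρ : ℝ) : Set ℂ := {z | (sqrtNeg z).re = ρ}

/-- The domain `D_ρ` inside the parabola; it contains `[0, ∞)` when `ρ > 0`. -/
def parabolaInterior (ρ : ℝ) : Set ℂ := {z | (sqrtNeg z).re < ρ}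

/-- The parametrization `z(t) = -(ρ + i t)² = t² - ρ² - 2 ρ t i` of `P_ρ`. For increasing `t` it
comes from infinity in the upper half plane, passes the vertex `-ρ²` at `t = 0` and leaves to
infinity in the lower half plane: this is the counterclockwise orientation. -/
def parabolaPath (ρ t : ℝ) : ℂ := -((ρ : ℂ) + (t : ℂ) * Complex.I) ^ 2

/-- The pulled back form `g(z(t)) z'(t)`. -/
def pullback (ρ : ℝ) (g : ℂ → ℂ) (t : ℝ) : ℂ :=
  g (parabolaPath ρ t) * deriv (parabolaPath ρ) t

/-- `∫_{P_ρ} g(z) dz = I` over the counterclockwise oriented parabola, as an improper integral: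
the limit, as `η → ∞`, of the integrals over the parts of `P_ρ` to the left of the vertical line
`Re z = η`, where `η = T² - ρ²`. -/
def HasParabolaIntegral (ρ : ℝ) (g : ℂ → ℂ) (I : ℂ) : Prop :=
  (∀ T : ℝ, IntervalIntegrable (pullback ρ g) volume (-T) T) ∧
    Tendsto (fun T : ℝ => ∫ t in (-T)..T, pullback ρ g t) atTop (𝓝 I)

/-- The path does parametrize the parabola. -/
theorem range_parabolaPath {ρ : ℝ} (hρ : 0 < ρ) :
    Set.range (parabolaPath ρ) = parabola ρ := by
  ext z
  constructor
  · rintro ⟨t, rfl⟩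
    have h0 : 0 < ((ρ : ℂ) + (t : ℂ) * Complex.I).re := by simpa using hρ
    have habs := Complex.abs_arg_lt_pi_div_two_iff.2 (Or.inl h0)
    rw [abs_lt] at habs
    have h : Complex.sqrt (((ρ : ℂ) + (t : ℂ) * Complex.I) ^ 2)
        = (ρ : ℂ) + (t : ℂ) * Complex.I := by
      have := Complex.pow_cpow_nat_inv (x := (ρ : ℂ) + (t : ℂ) * Complex.I) (n := 2)
        two_ne_zero (by push_cast; linarith [habs.1]) (by push_cast; linarith [habs.2])
      simpa [Complex.sqrt] using this
    simp only [parabola, sqrtNeg, parabolaPath, Set.mem_ofPred_eq, neg_neg, h]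
    simp
  · intro hz
    refine ⟨(sqrtNeg z).im, ?_⟩
    have h1 : (ρ : ℂ) + ((sqrtNeg z).im : ℂ) * Complex.I = sqrtNeg z := by
      have hz' : (sqrtNeg z).re = ρ := hz
      rw [← hz', Complex.re_add_im]
    have h2 : sqrtNeg z ^ 2 = -z := by
      have := Complex.cpow_nat_inv_pow (-z) (n := 2) two_ne_zero
      simpa [sqrtNeg, Complex.sqrt] using this
    rw [parabolaPath, h1, h2, neg_neg]

end

end LaguerreParabola

/-!
Put `z = -w²` and `x = y²`. The region `D_ρ ∪ P_ρ` is the image of the strip `0 ≤ Re w ≤ ρ`, the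
parabola is the image of the line `Re w = ρ`, and the imaginary axis is folded onto `[0, ∞)`. The
Cauchy kernel becomes `dz / (z - x) = 2w dw / (w² + y²)`.

For `T > 0` consider the three sides of the rectangle `[0, ρ] × [-T, T]` that do not lie on the
imaginary axis. The pullback of the difference quotient `(f(z) - f(x)) / (z - x) dz` is holomorphic
on the rectangle and odd, so its integral over the fourth side vanishes. By Cauchy's theorem the
integral of `f(z) / (z - x) dz` over the three sides is therefore `f(x)` times the change of
`log (w² + y²)`, which is `2πi` if `y < T` and `0` if `y > T` (`threeSides_cauchy`). Integrating
this against the weight and interchanging the integrals shows that the integral of `Φ_k f dz` over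
the three sides is the part of the inner product `⟨f, L_k⟩` over `x < T²` (`threeSides_stripForm`).
This tends to `⟨f, L_k⟩`, and the side on `Re w = ρ` gives the truncated integral over the parabola,
so the horizontal sides have to be shown to be negligible.

Since `L_k` is orthogonal to all lower powers (`integral_pow_mul_weight_mul_laguerreL`), the first
`k` terms of the expansion of `Φ_k` in powers of `1 / z` vanish. The lower bound
`|w² + y²| ≥ |Im w| (Re w)^{1/2} ||Im w| - y|^{1/2}` (`le_norm_sq_add_sq`) controls the remainder
up to the cut, and `|Φ_k(z)| ≤ C |z|^{-k-1} (1 + (Re w)^{-1/2})` follows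
(`exists_norm_cauchyPhi_neg_sq_le`). With `|f(z)| ≤ |K| |z|^β` the pulled back form is
`O(|Im w|^{2β - 2k - 1})` up to the integrable factor `1 + (Re w)^{-1/2}`. So the horizontal sides
tend to zero if `k > β - 1/2`, and the integral along `Re w = ρ` converges absolutely if `k > β`.
-/

namespace LaguerreParabola

/-! ### Vanishing moments of the Laguerre polynomials -/

lemma poch_pos {a : ℝ} (ha : 0 < a) (j : ℕ) : 0 < poch a j := ascPochhammer_pos j a ha

lemma poch_neg_natCast (k j : ℕ) :
    poch (-(k : ℝ)) j = (-1) ^ j * ((j.factorial : ℝ) * (k.choose j : ℝ)) := by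
  rw [poch, ascPochhammer_eval_neg_eq_descPochhammer, descPochhammer_eval_eq_descFactorial,
    Nat.descFactorial_eq_factorial_mul_choose]
  push_cast
  ring

lemma Gamma_add_natCast {s : ℝ} (hs : 0 < s) (n : ℕ) :
    Real.Gamma (s + n) = poch s n * Real.Gamma s := by
  induction n with
  | zero => simp [poch]
  | succ n ih =>
    have : s + n ≠ 0 := by positivity
    rw [Nat.cast_succ, ← add_assoc, Real.Gamma_add_one this, ih, poch, poch,
      ascPochhammer_succ_eval]
    ring

lemma laguerreL_eq_sum (α : ℝ) (k : ℕ) (x : ℝ) :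
    laguerreL α k x = ∑ j ∈ Finset.range (k + 1),
      poch (α + 1) k / (k.factorial : ℝ) *
        ((-1) ^ j * (k.choose j : ℝ) / poch (α + 1) j) * x ^ j := by
  rw [laguerreL, kummerM, tsum_eq_sum (s := Finset.range (k + 1)), Finset.mul_sum]
  · refine Finset.sum_congr rfl fun j _ => ?_
    rw [poch_neg_natCast]
    have : (j.factorial : ℝ) ≠ 0 := by positivity
    field_simp
  · intro j hj
    have : k < j := by simpa using hj
    rw [poch_neg_natCast, Nat.choose_eq_zero_of_lt this]
    simp

lemma continuous_laguerreL (α : ℝ) (k : ℕ) : Continuous (laguerreL α k) := by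
  rw [funext (laguerreL_eq_sum α k)]
  fun_prop

lemma pow_mul_weight {α x : ℝ} (hx : 0 < x) (m : ℕ) :
    x ^ m * weight α x = Real.exp (-x) * x ^ ((α + 1 + m) - 1) := by
  rw [weight, show α + 1 + m - 1 = α + m by ring, Real.rpow_add hx, Real.rpow_natCast]
  ring

lemma integrableOn_pow_mul_weight {α : ℝ} (hα : -1 < α) (m : ℕ) :
    IntegrableOn (fun x => x ^ m * weight α x) (Ioi 0) := by
  have h : 0 < α + 1 + m := by have : (0 : ℝ) ≤ m := by positivity
                               linarith
  exact (Real.GammaIntegral_convergent h).congr_fun (fun x hx => (pow_mul_weight hx m).symm)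
    measurableSet_Ioi

lemma integral_pow_mul_weight {α : ℝ} (hα : -1 < α) (m : ℕ) :
    ∫ x in Ioi 0, x ^ m * weight α x = Real.Gamma (α + 1 + m) := by
  have h : 0 < α + 1 + m := by have : (0 : ℝ) ≤ m := by positivity
                               linarith
  rw [Real.Gamma_eq_integral h]
  exact setIntegral_congr_fun measurableSet_Ioi (fun x hx => pow_mul_weight hx m)

lemma pow_mul_weight_mul_laguerreL (α : ℝ) (k m : ℕ) (x : ℝ) :
    x ^ m * (weight α x * laguerreL α k x) = ∑ j ∈ Finset.range (k + 1),
      poch (α + 1) k / (k.factorial : ℝ) *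
        ((-1) ^ j * (k.choose j : ℝ) / poch (α + 1) j) * (x ^ (m + j) * weight α x) := by
  rw [laguerreL_eq_sum, Finset.mul_sum, Finset.mul_sum]
  refine Finset.sum_congr rfl fun j _ => ?_
  ring

lemma integrableOn_pow_mul_weight_mul_laguerreL {α : ℝ} (hα : -1 < α) (k m : ℕ) :
    IntegrableOn (fun x => x ^ m * (weight α x * laguerreL α k x)) (Ioi 0) := by
  simp only [pow_mul_weight_mul_laguerreL]
  exact integrable_finsetSum _ fun j _ => (integrableOn_pow_mul_weight hα (m + j)).const_mul _

/-- Orthogonality to lower powers: the moment is, up to a factor, the `k`-th forward difference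
at `0` of `j ↦ (α + 1 + j)_m`, a polynomial of degree `m < k`. -/
lemma integral_pow_mul_weight_mul_laguerreL {α : ℝ} (hα : -1 < α) {k m : ℕ} (hm : m < k) :
    ∫ x in Ioi 0, x ^ m * (weight α x * laguerreL α k x) = 0 := by
  have hα' : 0 < α + 1 := by linarith
  simp only [pow_mul_weight_mul_laguerreL]
  rw [integral_finsetSum _ fun j _ => (integrableOn_pow_mul_weight hα (m + j)).const_mul _]
  simp only [integral_const_mul, integral_pow_mul_weight hα]
  set P : Polynomial ℝ := (ascPochhammer ℝ m).comp (Polynomial.X + Polynomial.C (α + 1)) with hP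
  have hdeg : P.natDegree < k := by
    rwa [hP, Polynomial.natDegree_comp, ascPochhammer_natDegree, Polynomial.natDegree_X_add_C,
      mul_one]
  have h0 := congrFun (Polynomial.fwdDiff_iter_eq_zero_of_degree_lt hdeg) 0
  rw [fwdDiff_iter_eq_sum_shift] at h0
  have key : ∀ j ∈ Finset.range (k + 1),
      poch (α + 1) k / (k.factorial : ℝ) * ((-1) ^ j * (k.choose j : ℝ) / poch (α + 1) j) *
        Real.Gamma (α + 1 + ((m + j : ℕ) : ℝ)) =
      poch (α + 1) k / (k.factorial : ℝ) * Real.Gamma (α + 1) * (-1) ^ k *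
        (((-1 : ℤ) ^ (k - j) * k.choose j) • P.eval (0 + j • (1 : ℝ))) := by
    intro j hj
    have hjk : j ≤ k := Nat.lt_succ_iff.1 (Finset.mem_range.1 hj)
    have e1 : Real.Gamma (α + 1 + ((m + j : ℕ) : ℝ))
        = poch (α + 1 + j) m * (poch (α + 1) j * Real.Gamma (α + 1)) := by
      rw [← Gamma_add_natCast hα' j, ← Gamma_add_natCast (by positivity) m]
      push_cast
      congr 1
      ring
    have e2 : P.eval (0 + j • (1 : ℝ)) = poch (α + 1 + j) m := by
      simp [hP, poch, add_comm]
    have e3 : ((-1 : ℝ)) ^ j = (-1) ^ k * (-1) ^ (k - j) := by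
      obtain ⟨i, rfl⟩ := Nat.exists_eq_add_of_le hjk
      rw [Nat.add_sub_cancel_left, pow_add, mul_assoc, ← pow_add, Even.neg_one_pow ⟨i, rfl⟩,
        mul_one]
    have := (poch_pos hα' j).ne'
    rw [e1, e2, e3, zsmul_eq_mul]
    push_cast
    field_simp
  rw [Finset.sum_congr rfl key, ← Finset.mul_sum, h0]
  simp

/-! ### The substitution `x = y²` -/

lemma integral_Ioi_eq_integral_comp_sq (g : ℝ → ℂ) :
    ∫ x in Ioi (0 : ℝ), g x = ∫ y in Ioi (0 : ℝ), ((2 * y : ℝ) : ℂ) * g (y ^ 2) := by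
  rw [← integral_comp_rpow_Ioi_of_pos (g := g) two_pos]
  refine setIntegral_congr_fun measurableSet_Ioi fun y _ => ?_
  norm_num

lemma integrableOn_comp_sq {E : Type*} [NormedAddCommGroup E] [NormedSpace ℝ E] {g : ℝ → E}
    (hg : IntegrableOn g (Ioi 0)) : IntegrableOn (fun y => (2 * y) • g (y ^ 2)) (Ioi 0) := by
  refine ((integrableOn_Ioi_comp_rpow_iff g two_ne_zero).2 hg).congr_fun (fun y _ => ?_)
    measurableSet_Ioi
  norm_num

/-- The density of `ω_α(x) L_k^{(α)}(x) dx` in the variable `y = √x`. -/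
noncomputable def sqrtDensity (α : ℝ) (k : ℕ) (y : ℝ) : ℝ :=
  2 * y * (weight α (y ^ 2) * laguerreL α k (y ^ 2))

lemma measurable_weight (α : ℝ) : Measurable (weight α) := by
  unfold weight
  fun_prop

lemma measurable_sqrtDensity (α : ℝ) (k : ℕ) : Measurable (sqrtDensity α k) := by
  have h1 := measurable_weight α
  have h2 := (continuous_laguerreL α k).measurable
  unfold sqrtDensity
  fun_prop

lemma integrableOn_pow_mul_sqrtDensity {α : ℝ} (hα : -1 < α) (k m : ℕ) :
    IntegrableOn (fun y => (y ^ 2) ^ m * sqrtDensity α k y) (Ioi 0) := by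
  refine (integrableOn_comp_sq (integrableOn_pow_mul_weight_mul_laguerreL hα k m)).congr_fun
    (fun y _ => ?_) measurableSet_Ioi
  simp only [sqrtDensity, smul_eq_mul]
  ring

lemma integrableOn_sqrtDensity {α : ℝ} (hα : -1 < α) (k : ℕ) :
    IntegrableOn (sqrtDensity α k) (Ioi 0) := by
  simpa using integrableOn_pow_mul_sqrtDensity hα k 0

lemma integral_pow_mul_sqrtDensity {α : ℝ} (hα : -1 < α) {k m : ℕ} (hm : m < k) :
    ∫ y in Ioi (0 : ℝ), (y : ℂ) ^ (2 * m) * (sqrtDensity α k y : ℂ) = 0 := by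
  have h := integral_Ioi_eq_integral_comp_sq
    (fun x => ((x ^ m * (weight α x * laguerreL α k x) : ℝ) : ℂ))
  rw [integral_complex_ofReal, integral_pow_mul_weight_mul_laguerreL hα hm] at h
  rw [← Complex.ofReal_zero, h]
  refine setIntegral_congr_fun measurableSet_Ioi fun y _ => ?_
  simp only [sqrtDensity]
  push_cast
  ring

lemma exists_rpow_mul_exp_neg_le {r : ℝ} (hr : 0 ≤ r) :
    ∃ B : ℝ, ∀ x : ℝ, 0 < x → x ^ r * Real.exp (-x) ≤ B := by
  obtain ⟨n, hn⟩ := exists_nat_ge r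
  refine ⟨1 + n.factorial, fun x hx => ?_⟩
  have h1 : x ^ r ≤ 1 + x ^ n := by
    rcases le_total x 1 with h | h
    · have := Real.rpow_le_one hx.le h hr
      have : 0 ≤ x ^ n := by positivity
      linarith
    · have := Real.rpow_le_rpow_of_exponent_le h hn
      rw [Real.rpow_natCast] at this
      linarith
  have h2 : x ^ n * Real.exp (-x) ≤ n.factorial := by
    have := Real.pow_div_factorial_le_exp x hx.le n
    rw [div_le_iff₀ (by positivity)] at this
    rw [Real.exp_neg, ← div_eq_mul_inv, div_le_iff₀ (Real.exp_pos x)]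
    linarith
  have h3 : Real.exp (-x) ≤ 1 := Real.exp_le_one_iff.2 (by linarith)
  calc x ^ r * Real.exp (-x) ≤ (1 + x ^ n) * Real.exp (-x) := by gcongr
    _ = Real.exp (-x) + x ^ n * Real.exp (-x) := by ring
    _ ≤ _ := add_le_add h3 h2

/-- The factor `y²` compensates the singularity at `0` of the density, which is of order
`y^{2α + 1}` with `2α + 1 > -1`. -/
lemma exists_abs_pow_mul_sqrtDensity_le {α : ℝ} (hα : -1 < α) (k m : ℕ) :
    ∃ B : ℝ, ∀ y : ℝ, 0 < y → |(y ^ 2) ^ (m + 1) * sqrtDensity α k y| ≤ B := by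
  have hr : ∀ j : ℕ, 0 ≤ 3 / 2 + α + ((m + j : ℕ) : ℝ) := fun j => by
    have : (0 : ℝ) ≤ ((m + j : ℕ) : ℝ) := by positivity
    linarith
  choose B hB using fun j => exists_rpow_mul_exp_neg_le (hr j)
  set c : ℕ → ℝ := fun j => poch (α + 1) k / (k.factorial : ℝ) *
        ((-1) ^ j * (k.choose j : ℝ) / poch (α + 1) j) with hc
  refine ⟨∑ j ∈ Finset.range (k + 1), 2 * |c j| * B j, fun y hy => ?_⟩
  have hx : 0 < y ^ 2 := by positivity
  have hy2 : y = (y ^ 2) ^ (1 / 2 : ℝ) := by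
    rw [← Real.sqrt_eq_rpow, Real.sqrt_sq hy.le]
  have e : (y ^ 2) ^ (m + 1) * sqrtDensity α k y = ∑ j ∈ Finset.range (k + 1),
      2 * c j * ((y ^ 2) ^ (3 / 2 + α + ((m + j : ℕ) : ℝ)) * Real.exp (-y ^ 2)) := by
    rw [sqrtDensity, laguerreL_eq_sum, Finset.mul_sum, Finset.mul_sum, Finset.mul_sum]
    refine Finset.sum_congr rfl fun j _ => ?_
    rw [show (3 / 2 + α + ((m + j : ℕ) : ℝ)) = 1 / 2 + α + ((m + 1 + j : ℕ) : ℝ) by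
      push_cast; ring, Real.rpow_add hx, Real.rpow_add hx, Real.rpow_natCast, ← hy2, weight, hc]
    ring
  rw [e]
  refine (Finset.abs_sum_le_sum_abs _ _).trans (Finset.sum_le_sum fun j _ => ?_)
  rw [abs_mul, abs_mul, abs_two, abs_of_nonneg (by positivity : 0 ≤ (y ^ 2) ^
    (3 / 2 + α + ((m + j : ℕ) : ℝ)) * Real.exp (-y ^ 2))]
  exact mul_le_mul_of_nonneg_left (hB j _ hx) (by positivity)

/-! ### Bounds for the Cauchy kernel in the variables `w = √(-z)`, `y = √x` -/

lemma intervalIntegrable_inv_sqrt {b : ℝ} (hb : 0 ≤ b) :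
    IntervalIntegrable (fun s : ℝ => (√s)⁻¹) volume 0 b := by
  refine (intervalIntegral.intervalIntegrable_rpow' (a := 0) (b := b)
    (r := -(1 / 2)) (by norm_num)).congr fun s hs => ?_
  rw [uIoc_of_le hb] at hs
  rw [Real.sqrt_eq_rpow, Real.rpow_neg hs.1.le]

lemma integrable_indicator_inv_sqrt_abs :
    Integrable (indicator (Ioc (-1 : ℝ) 1) fun u => (√|u|)⁻¹) := by
  have h1 : IntervalIntegrable (fun u : ℝ => (√|u|)⁻¹) volume 0 1 := by
    refine (intervalIntegrable_inv_sqrt zero_le_one).congr fun u hu => ?_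
    rw [uIoc_of_le zero_le_one] at hu
    rw [abs_of_pos hu.1]
  have h2 : IntervalIntegrable (fun u : ℝ => (√|u|)⁻¹) volume (-1) 0 := by
    have := (IntervalIntegrable.iff_comp_neg (by simp)).1 h1
    simpa using this.symm
  have h3 := h2.trans h1
  rw [intervalIntegrable_iff_integrableOn_Ioc_of_le (by norm_num)] at h3
  exact h3.integrable_indicator measurableSet_Ioc

/-- A bounded integrable function has uniformly bounded integrals against the translates of the
kernel `|T - y|^{-1/2}`. -/
lemma exists_integral_mul_inv_sqrt_abs_le {V : ℝ → ℝ} (hV : IntegrableOn V (Ioi 0))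
    (hm : Measurable V) (h0 : ∀ y, 0 < y → 0 ≤ V y) {B : ℝ} (hB : ∀ y, 0 < y → V y ≤ B) :
    ∃ C : ℝ, ∀ T : ℝ, IntegrableOn (fun y => V y * (√|T - y|)⁻¹) (Ioi 0) ∧
      ∫ y in Ioi 0, V y * (√|T - y|)⁻¹ ≤ C := by
  set G : ℝ → ℝ := indicator (Ioc (-1 : ℝ) 1) fun u => (√|u|)⁻¹ with hG
  have hGi : Integrable G := integrable_indicator_inv_sqrt_abs
  have hG0 : ∀ u, 0 ≤ G u := fun u => indicator_nonneg (fun _ _ => by positivity) u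
  have hB0 : 0 ≤ B := (h0 1 one_pos).trans (hB 1 one_pos)
  have hle : ∀ T y, 0 < y → V y * (√|T - y|)⁻¹ ≤ V y + B * G (T - y) := by
    intro T y hy
    by_cases hu : T - y ∈ Ioc (-1 : ℝ) 1
    · rw [hG, indicator_of_mem hu]
      have : V y * (√|T - y|)⁻¹ ≤ B * (√|T - y|)⁻¹ := by
        gcongr
        exact hB y hy
      linarith [h0 y hy]
    · have h1 : 1 ≤ |T - y| := by
        by_contra! h
        exact hu ⟨by linarith [(abs_lt.1 h).1], (abs_lt.1 h).2.le⟩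
      have h2 : (√|T - y|)⁻¹ ≤ 1 := inv_le_one_of_one_le₀ (Real.one_le_sqrt.2 h1)
      have := mul_le_mul_of_nonneg_left h2 (h0 y hy)
      have := mul_nonneg hB0 (hG0 (T - y))
      linarith
  have hint : ∀ T, IntegrableOn (fun y => V y + B * G (T - y)) (Ioi 0) := fun T =>
    hV.add ((hGi.comp_sub_left T).const_mul B).integrableOn
  have hI : ∀ T, IntegrableOn (fun y => V y * (√|T - y|)⁻¹) (Ioi 0) := by
    intro T
    refine (hint T).mono' (by fun_prop) ?_
    filter_upwards [ae_restrict_mem measurableSet_Ioi] with y hy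
    rw [Real.norm_of_nonneg (mul_nonneg (h0 y hy) (by positivity))]
    exact hle T y hy
  refine ⟨(∫ y in Ioi 0, V y) + B * ∫ u, G u, fun T => ⟨hI T, ?_⟩⟩
  calc ∫ y in Ioi 0, V y * (√|T - y|)⁻¹
      ≤ ∫ y in Ioi 0, (V y + B * G (T - y)) :=
        setIntegral_mono_on (hI T) (hint T) measurableSet_Ioi fun y hy => hle T y hy
    _ = (∫ y in Ioi 0, V y) + B * ∫ y in Ioi 0, G (T - y) := by
        rw [integral_add hV ((hGi.comp_sub_left T).const_mul B).integrableOn,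
          integral_const_mul]
    _ ≤ _ := by
        gcongr
        rw [← integral_sub_left_eq_self G volume T]
        exact setIntegral_le_integral (hGi.comp_sub_left T) (ae_of_all _ fun y => hG0 _)

lemma sq_add_sq_eq_mul (w : ℂ) (y : ℝ) :
    w ^ 2 + (y : ℂ) ^ 2 = (w + y * Complex.I) * (w - y * Complex.I) := by
  linear_combination ((y : ℂ) ^ 2) * Complex.I_sq

lemma re_sq_le_norm_sq_add_sq {w : ℂ} (hw : 0 ≤ w.re) (y : ℝ) :
    w.re ^ 2 ≤ ‖w ^ 2 + (y : ℂ) ^ 2‖ := by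
  rw [sq_add_sq_eq_mul, norm_mul, sq]
  have h1 := Complex.re_le_norm (w + y * Complex.I)
  have h2 := Complex.re_le_norm (w - y * Complex.I)
  simp only [Complex.add_re, Complex.sub_re, Complex.mul_re, Complex.ofReal_re, Complex.I_re,
    mul_zero, Complex.ofReal_im, Complex.I_im, mul_one, sub_self, add_zero, sub_zero] at h1 h2
  exact mul_le_mul h1 h2 hw (norm_nonneg _)

lemma sq_add_sq_ne_zero {w : ℂ} (hw : 0 < w.re) (y : ℝ) : w ^ 2 + (y : ℂ) ^ 2 ≠ 0 := by
  have := re_sq_le_norm_sq_add_sq hw.le y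
  rw [← norm_pos_iff]
  exact lt_of_lt_of_le (by positivity) this

lemma sqrt_re_mul_sqrt_im_le_norm (u : ℂ) : √u.re * √|u.im| ≤ ‖u‖ := by
  calc √u.re * √|u.im| ≤ √‖u‖ * √‖u‖ := by
        gcongr
        · exact Complex.re_le_norm u
        · exact Complex.abs_im_le_norm u
    _ = ‖u‖ := Real.mul_self_sqrt (norm_nonneg u)

/-- The factor of `w² + y² = (w + iy)(w - iy)` that stays away from zero is bounded below by
`|Im w|`, the other one by the geometric mean of its real and imaginary parts. -/
lemma le_norm_sq_add_sq (w : ℂ) {y : ℝ} (hy : 0 ≤ y) :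
    |w.im| * (√w.re * √|(|w.im| - y)|) ≤ ‖w ^ 2 + (y : ℂ) ^ 2‖ := by
  have h1 := Complex.abs_im_le_norm (w + y * Complex.I)
  have h2 := Complex.abs_im_le_norm (w - y * Complex.I)
  have h3 := sqrt_re_mul_sqrt_im_le_norm (w + y * Complex.I)
  have h4 := sqrt_re_mul_sqrt_im_le_norm (w - y * Complex.I)
  simp only [Complex.add_re, Complex.sub_re, Complex.mul_re, Complex.ofReal_re, Complex.I_re,
    mul_zero, Complex.ofReal_im, Complex.I_im, mul_one, sub_self, add_zero, sub_zero,
    Complex.add_im, Complex.sub_im, Complex.mul_im] at h1 h2 h3 h4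
  rw [sq_add_sq_eq_mul, norm_mul]
  rcases le_total 0 w.im with h | h
  · rw [abs_of_nonneg h]
    refine mul_le_mul (le_trans ?_ h1) h4 (by positivity) (norm_nonneg _)
    rw [abs_of_nonneg (by linarith)]
    linarith
  · rw [abs_of_nonpos h, mul_comm ‖w + _‖]
    refine mul_le_mul (le_trans ?_ h2) (le_trans (le_of_eq ?_) h3) (by positivity)
      (norm_nonneg _)
    · rw [abs_of_nonpos (by linarith)]
      linarith
    · rw [← abs_neg (w.im + y)]
      ring_nf

/-! ### Decay of the weighted Cauchy transform -/

lemma cauchyPhi_neg_sq (α : ℝ) (k : ℕ) (w : ℂ) :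
    cauchyPhi α k (-w ^ 2) = -(1 / (2 * (Real.pi : ℂ) * Complex.I)) *
      ∫ y in Ioi (0 : ℝ), (sqrtDensity α k y : ℂ) / (w ^ 2 + (y : ℂ) ^ 2) := by
  rw [cauchyPhi, integral_Ici_eq_integral_Ioi, integral_Ioi_eq_integral_comp_sq, neg_mul,
    ← mul_neg, ← integral_neg]
  congr 1
  refine setIntegral_congr_fun measurableSet_Ioi fun y _ => ?_
  simp only [sqrtDensity]
  rw [← div_neg, neg_add, ← sub_eq_add_neg]
  push_cast
  ring

lemma integrableOn_div_sq_add_sq {g : ℝ → ℂ} (hg : IntegrableOn g (Ioi 0)) {w : ℂ}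
    (hw : 0 < w.re) : IntegrableOn (fun y : ℝ => g y / (w ^ 2 + (y : ℂ) ^ 2)) (Ioi 0) := by
  simp only [div_eq_mul_inv]
  refine Integrable.mul_bdd (c := (w.re ^ 2)⁻¹) hg (by fun_prop) (ae_of_all _ fun y => ?_)
  rw [norm_inv]
  exact inv_anti₀ (by positivity) (re_sq_le_norm_sq_add_sq hw.le y)

lemma integrableOn_ofReal_pow_mul_sqrtDensity {α : ℝ} (hα : -1 < α) (k m : ℕ) :
    IntegrableOn (fun y : ℝ => (y : ℂ) ^ (2 * m) * (sqrtDensity α k y : ℂ)) (Ioi 0) := by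
  have h : IntegrableOn (fun y : ℝ => (((y ^ 2) ^ m * sqrtDensity α k y : ℝ) : ℂ)) (Ioi 0) :=
    Integrable.ofReal (integrableOn_pow_mul_sqrtDensity hα k m)
  refine h.congr_fun (fun y _ => ?_) measurableSet_Ioi
  push_cast
  ring

/-- Orthogonality removes the first `k` terms of the expansion of `1 / (z - x)` in powers
of `1 / z`, where `z = -w²`. -/
lemma neg_sq_pow_mul_integral {α : ℝ} (hα : -1 < α) (k : ℕ) {w : ℂ} (hw : 0 < w.re) :
    (-w ^ 2) ^ (k + 1) * ∫ y in Ioi (0 : ℝ), (sqrtDensity α k y : ℂ) / (w ^ 2 + (y : ℂ) ^ 2) =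
      (∫ y in Ioi (0 : ℝ),
        (y : ℂ) ^ (2 * (k + 1)) * (sqrtDensity α k y : ℂ) / (w ^ 2 + (y : ℂ) ^ 2)) -
      ∫ y in Ioi (0 : ℝ), (y : ℂ) ^ (2 * k) * (sqrtDensity α k y : ℂ) := by
  have hi := integrableOn_ofReal_pow_mul_sqrtDensity hα k
  have hsum : ∑ j ∈ Finset.range (k + 1), (-w ^ 2) ^ (k - j) *
      ∫ y in Ioi (0 : ℝ), (y : ℂ) ^ (2 * j) * (sqrtDensity α k y : ℂ) =
      ∫ y in Ioi (0 : ℝ), (y : ℂ) ^ (2 * k) * (sqrtDensity α k y : ℂ) := by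
    rw [Finset.sum_range_succ, Finset.sum_eq_zero fun j hj => ?_]
    · simp
    · rw [integral_pow_mul_sqrtDensity hα (Finset.mem_range.1 hj), mul_zero]
  rw [← hsum, ← integral_const_mul]
  simp only [← integral_const_mul]
  rw [← integral_finsetSum _ fun j _ => (hi j).const_mul _,
    ← integral_sub (integrableOn_div_sq_add_sq (hi (k + 1)) hw)
      (integrable_finsetSum _ fun j _ => (hi j).const_mul _)]
  refine setIntegral_congr_fun measurableSet_Ioi fun y _ => ?_
  have h0 := sq_add_sq_ne_zero hw y
  have hg := geom_sum₂_mul ((y : ℂ) ^ 2) (-w ^ 2) (k + 1)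
  have e : ∑ j ∈ Finset.range (k + 1), (-w ^ 2) ^ (k - j) *
      ((y : ℂ) ^ (2 * j) * (sqrtDensity α k y : ℂ)) =
      (∑ i ∈ Finset.range (k + 1), ((y : ℂ) ^ 2) ^ i * (-w ^ 2) ^ (k + 1 - 1 - i)) *
        sqrtDensity α k y := by
    rw [Finset.sum_mul]
    refine Finset.sum_congr rfl fun j _ => ?_
    rw [Nat.add_sub_cancel, pow_mul]
    ring
  rw [e, eq_sub_iff_add_eq, ← mul_div_assoc, div_add' _ _ _ h0, pow_mul]
  congr 1
  linear_combination (sqrtDensity α k y : ℂ) * hg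

/-- The decay `Φ_k(z) = O(|z|^{-k-1})` in the plane cut along `[0, ∞)`, with an integrable
singularity at the cut, where `z = -w²`. -/
lemma exists_norm_cauchyPhi_neg_sq_le {α : ℝ} (hα : -1 < α) (k : ℕ) :
    ∃ C : ℝ, 0 ≤ C ∧ ∀ w : ℂ, 0 < w.re → 1 ≤ |w.im| →
      ‖cauchyPhi α k (-w ^ 2)‖ * ‖w‖ ^ (2 * (k + 1)) ≤ C * (1 + (√w.re)⁻¹) := by
  obtain ⟨B, hB⟩ := exists_abs_pow_mul_sqrtDensity_le hα k k
  set V : ℝ → ℝ := fun y => |(y ^ 2) ^ (k + 1) * sqrtDensity α k y| with hV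
  have hVm : Measurable V := by
    have := measurable_sqrtDensity α k
    have h : Measurable fun y => (y ^ 2) ^ (k + 1) * sqrtDensity α k y := by fun_prop
    exact h.norm
  obtain ⟨C, hC⟩ := exists_integral_mul_inv_sqrt_abs_le (V := V)
    (integrableOn_pow_mul_sqrtDensity hα k (k + 1)).norm hVm (fun y _ => abs_nonneg _) hB
  set M : ℝ := ‖∫ y in Ioi (0 : ℝ), (y : ℂ) ^ (2 * k) * (sqrtDensity α k y : ℂ)‖ with hM
  set c : ℝ := ‖-(1 / (2 * (Real.pi : ℂ) * Complex.I))‖ with hc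
  have hC0 : 0 ≤ C := (integral_nonneg fun y => by positivity).trans (hC 0).2
  refine ⟨c * (M + C), by positivity, fun w hw him => ?_⟩
  have hbound : ‖∫ y in Ioi (0 : ℝ),
      (y : ℂ) ^ (2 * (k + 1)) * (sqrtDensity α k y : ℂ) / (w ^ 2 + (y : ℂ) ^ 2)‖
      ≤ (√w.re)⁻¹ * C := by
    calc _ ≤ ∫ y in Ioi (0 : ℝ), (√w.re)⁻¹ * (V y * (√|(|w.im| - y)|)⁻¹) := by
          refine norm_integral_le_of_norm_le ((hC |w.im|).1.const_mul _) ?_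
          have hne : ∀ᵐ y ∂(volume.restrict (Ioi (0 : ℝ))), y ≠ |w.im| :=
            ae_restrict_of_ae (by simp [ae_iff, measure_singleton])
          filter_upwards [ae_restrict_mem measurableSet_Ioi, hne] with y hy hne
          have hpos : 0 < √w.re * √|(|w.im| - y)| :=
            mul_pos (Real.sqrt_pos.2 hw) (Real.sqrt_pos.2 (abs_pos.2 (sub_ne_zero.2 hne.symm)))
          have h1 : √w.re * √|(|w.im| - y)| ≤ ‖w ^ 2 + (y : ℂ) ^ 2‖ :=
            (le_mul_of_one_le_left hpos.le him).trans (le_norm_sq_add_sq w (le_of_lt hy))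
          have h2 : ‖(y : ℂ) ^ (2 * (k + 1)) * (sqrtDensity α k y : ℂ)‖ = V y := by
            change _ = |_|
            rw [pow_mul, ← Real.norm_eq_abs, ← Complex.norm_real]
            push_cast
            rfl
          rw [norm_div, h2, mul_left_comm, ← mul_inv, ← div_eq_mul_inv]
          exact div_le_div_of_nonneg_left (abs_nonneg _) hpos h1
      _ = (√w.re)⁻¹ * ∫ y in Ioi (0 : ℝ), V y * (√|(|w.im| - y)|)⁻¹ := integral_const_mul _ _
      _ ≤ _ := by
          gcongr
          exact (hC _).2
  have hn : ‖w‖ ^ (2 * (k + 1)) = ‖(-w ^ 2) ^ (k + 1)‖ := by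
    rw [norm_pow, norm_neg, norm_pow, pow_mul]
  rw [cauchyPhi_neg_sq, norm_mul, ← hc, hn, mul_assoc, mul_comm ‖∫ y in _, _‖, ← norm_mul,
    neg_sq_pow_mul_integral hα k hw, mul_assoc c (M + C)]
  refine mul_le_mul_of_nonneg_left ((norm_sub_le _ _).trans ?_) (norm_nonneg _)
  have h3 : 0 ≤ (√w.re)⁻¹ := by positivity
  have h4 : 0 ≤ M := norm_nonneg _
  nlinarith [mul_nonneg h3 h4]

lemma continuous_cauchyPhi_neg_sq {α : ℝ} (hα : -1 < α) (k : ℕ) {ρ : ℝ} (hρ : 0 < ρ) {p : ℝ → ℂ}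
    (hp : Continuous p) (hre : ∀ t, ρ ≤ (p t).re) :
    Continuous fun t => cauchyPhi α k (-p t ^ 2) := by
  simp only [cauchyPhi_neg_sq]
  refine continuous_const.mul (continuous_of_dominated
    (bound := fun y => |sqrtDensity α k y| * (ρ ^ 2)⁻¹) (fun t => ?_) (fun t => ?_) ?_ ?_)
  · have := measurable_sqrtDensity α k
    simp only [div_eq_mul_inv]
    fun_prop
  · refine ae_of_all _ fun y => ?_
    rw [norm_div, Complex.norm_real, div_eq_mul_inv, Real.norm_eq_abs]
    gcongr
    exact (pow_le_pow_left₀ hρ.le (hre t) 2).trans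
      (re_sq_le_norm_sq_add_sq (hρ.le.trans (hre t)) y)
  · exact (integrableOn_sqrtDensity hα k).norm.mul_const _
  · refine ae_of_all _ fun y => ?_
    exact continuous_const.div (by fun_prop)
      fun t => sq_add_sq_ne_zero (hρ.trans_le (hre t)) y

/-! ### Cauchy's formula on the parabolic region, pulled back to a strip -/

lemma sqrtNeg_neg_sq_re {w : ℂ} (hw : 0 ≤ w.re) : (sqrtNeg (-w ^ 2)).re = w.re := by
  have h1 : sqrtNeg (-w ^ 2) ^ 2 = w ^ 2 := by
    simp [sqrtNeg, Complex.sqrt]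
  have h2 : 0 ≤ (sqrtNeg (-w ^ 2)).re := by
    have := Complex.cpow_inv_two_re (w ^ 2)
    rw [sqrtNeg, neg_neg, Complex.sqrt, this]
    positivity
  rcases sq_eq_sq_iff_eq_or_eq_neg.1 h1 with h | h
  · rw [h]
  · rw [h] at h2 ⊢
    rw [Complex.neg_re] at *
    linarith

lemma neg_sq_mem_union {ρ : ℝ} {w : ℂ} (h0 : 0 ≤ w.re) (h1 : w.re ≤ ρ) :
    -w ^ 2 ∈ parabolaInterior ρ ∪ parabola ρ := by
  rcases h1.lt_or_eq with h | h
  · exact Or.inl (by rwa [parabolaInterior, mem_ofPred_eq, sqrtNeg_neg_sq_re h0])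
  · exact Or.inr (by rwa [parabola, mem_ofPred_eq, sqrtNeg_neg_sq_re h0])

lemma ofReal_sq_mem_union {ρ : ℝ} (hρ : 0 < ρ) (y : ℝ) :
    (y : ℂ) ^ 2 ∈ parabolaInterior ρ ∪ parabola ρ := by
  have h := neg_sq_mem_union (ρ := ρ) (w := y * Complex.I) (by simp) (by simpa using hρ.le)
  rwa [mul_pow, Complex.I_sq, mul_neg_one, neg_neg] at h

/-- The integral of `q` along the three sides of the rectangle `[0, ρ] × [-T, T]` other than the
one on the imaginary axis, from `-iT` to `iT`. Under `w ↦ -w²` that last side is folded onto the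
cut `[0, T²]`. -/
noncomputable def threeSides (ρ T : ℝ) (q : ℂ → ℂ) : ℂ :=
  (∫ s in (0 : ℝ)..ρ, q (s + ((-T : ℝ) : ℂ) * Complex.I)) -
    (∫ s in (0 : ℝ)..ρ, q (s + (T : ℂ) * Complex.I)) +
    Complex.I * ∫ t in (-T)..T, q ((ρ : ℂ) + t * Complex.I)

lemma add_mem_slitPlane {y T : ℝ} (hy : 0 < y) (hyT : y ≠ T) {w : ℂ}
    (hw : 0 < w.re ∨ |w.im| = T) :
    w + y * Complex.I ∈ Complex.slitPlane ∧ w - y * Complex.I ∈ Complex.slitPlane := by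
  simp only [Complex.mem_slitPlane_iff, Complex.add_re, Complex.sub_re, Complex.mul_re,
    Complex.ofReal_re, Complex.I_re, mul_zero, Complex.ofReal_im, Complex.I_im, mul_one, sub_self,
    add_zero, sub_zero, Complex.add_im, Complex.sub_im, Complex.mul_im]
  rcases hw with h | h
  · exact ⟨Or.inl h, Or.inl h⟩
  · refine ⟨Or.inr fun h0 => hyT ?_, Or.inr fun h0 => hyT ?_⟩
    · rw [← h, show w.im = -y by linarith, abs_neg, abs_of_pos hy]
    · rw [← h, show w.im = y by linarith, abs_of_pos hy]

lemma sq_add_sq_ne_zero' {y T : ℝ} (hy : 0 < y) (hyT : y ≠ T) {w : ℂ}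
    (hw : 0 < w.re ∨ |w.im| = T) : w ^ 2 + (y : ℂ) ^ 2 ≠ 0 := by
  obtain ⟨h1, h2⟩ := add_mem_slitPlane hy hyT hw
  rw [sq_add_sq_eq_mul]
  exact mul_ne_zero (Complex.slitPlane_ne_zero h1) (Complex.slitPlane_ne_zero h2)

lemma hasDerivAt_log_add_log {y T : ℝ} (hy : 0 < y) (hyT : y ≠ T) {w : ℂ}
    (hw : 0 < w.re ∨ |w.im| = T) :
    HasDerivAt (fun w : ℂ => Complex.log (w + y * Complex.I) + Complex.log (w - y * Complex.I))
      (2 * w / (w ^ 2 + (y : ℂ) ^ 2)) w := by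
  obtain ⟨h1, h2⟩ := add_mem_slitPlane hy hyT hw
  have h := (((hasDerivAt_id w).add_const ((y : ℂ) * Complex.I)).clog h1).add
    (((hasDerivAt_id w).sub_const ((y : ℂ) * Complex.I)).clog h2)
  refine h.congr_deriv ?_
  have n1 := Complex.slitPlane_ne_zero h1
  have n2 := Complex.slitPlane_ne_zero h2
  rw [sq_add_sq_eq_mul]
  simp only [id]
  rw [div_add_div _ _ n1 n2]
  congr 1
  ring

lemma log_ofReal_mul_I {r : ℝ} (hr : 0 < r) :
    Complex.log (r * Complex.I) = Real.log r + Real.pi / 2 * Complex.I := by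
  rw [Complex.log_ofReal_mul hr Complex.I_ne_zero, Complex.log_I]

lemma log_ofReal_mul_neg_I {r : ℝ} (hr : 0 < r) :
    Complex.log (r * -Complex.I) = Real.log r - Real.pi / 2 * Complex.I := by
  rw [Complex.log_ofReal_mul hr (neg_ne_zero.2 Complex.I_ne_zero), Complex.log_neg_I]
  ring

lemma continuousOn_two_mul_div {y T : ℝ} (hy : 0 < y) (hyT : y ≠ T) :
    ContinuousOn (fun w : ℂ => 2 * w / (w ^ 2 + (y : ℂ) ^ 2)) {w | 0 < w.re ∨ |w.im| = T} :=
  ContinuousOn.div (by fun_prop) (by fun_prop) fun _ hw => sq_add_sq_ne_zero' hy hyT hw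

lemma mem_side_horizontal {T c : ℝ} (hc : |c| = T) (s : ℝ) :
    (s : ℂ) + (c : ℂ) * Complex.I ∈ {w : ℂ | 0 < w.re ∨ |w.im| = T} := by
  right
  simpa using hc

lemma mem_side_vertical {T ρ : ℝ} (hρ : 0 < ρ) (t : ℝ) :
    (ρ : ℂ) + (t : ℂ) * Complex.I ∈ {w : ℂ | 0 < w.re ∨ |w.im| = T} := by
  left
  simpa using hρ

/-- The winding contribution: the logarithm of `w² + y²` increases by `2πi` along the three
sides if its zeros `±iy` lie on the fourth one, and returns to its initial value otherwise. -/
lemma threeSides_two_mul_div {ρ y T : ℝ} (hρ : 0 < ρ) (hy : 0 < y) (hT : 0 < T) (hyT : y ≠ T) :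
    threeSides ρ T (fun w => 2 * w / (w ^ 2 + (y : ℂ) ^ 2)) =
      if y < T then 2 * Real.pi * Complex.I else 0 := by
  set P : ℂ → ℂ :=
    fun w => Complex.log (w + y * Complex.I) + Complex.log (w - y * Complex.I) with hP
  have hcont := continuousOn_two_mul_div hy hyT
  have hh : ∀ c : ℝ, |c| = T → ∫ s in (0 : ℝ)..ρ, (fun w => 2 * w / (w ^ 2 + (y : ℂ) ^ 2))
      ((s : ℂ) + (c : ℂ) * Complex.I) = P (ρ + c * Complex.I) - P (c * Complex.I) := by
    intro c hc
    rw [intervalIntegral.integral_eq_sub_of_hasDerivAt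
      (f := fun s : ℝ => P (s + c * Complex.I))]
    · simp
    · intro s _
      have h1 : HasDerivAt (fun s : ℝ => (s : ℂ) + c * Complex.I) 1 s :=
        Complex.ofRealCLM.hasDerivAt.add_const _
      have := (hasDerivAt_log_add_log hy hyT (mem_side_horizontal hc s)).comp s h1
      exact this.congr_deriv (mul_one _)
    · exact (hcont.comp_continuous (by fun_prop)
        (mem_side_horizontal hc)).intervalIntegrable _ _
  have hv : Complex.I * ∫ t in (-T)..T, (fun w => 2 * w / (w ^ 2 + (y : ℂ) ^ 2))
      ((ρ : ℂ) + t * Complex.I) = P (ρ + T * Complex.I) - P (ρ + (-T : ℝ) * Complex.I) := by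
    rw [← intervalIntegral.integral_const_mul, intervalIntegral.integral_eq_sub_of_hasDerivAt
      (f := fun t : ℝ => P (ρ + t * Complex.I))]
    · intro t _
      have h1 : HasDerivAt (fun t : ℝ => (ρ : ℂ) + t * Complex.I) (1 * Complex.I) t :=
        (Complex.ofRealCLM.hasDerivAt.mul_const _).const_add _
      have := (hasDerivAt_log_add_log hy hyT (mem_side_vertical hρ t)).comp t h1
      exact this.congr_deriv (by ring)
    · exact (continuous_const.mul (hcont.comp_continuous (by fun_prop)
        (mem_side_vertical hρ))).intervalIntegrable _ _
  have hsum : threeSides ρ T (fun w => 2 * w / (w ^ 2 + (y : ℂ) ^ 2)) =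
      P (T * Complex.I) - P ((-T : ℝ) * Complex.I) := by
    rw [threeSides, hv, hh (-T) (by rw [abs_neg, abs_of_pos hT]), hh T (abs_of_pos hT)]
    ring
  rw [hsum, hP]
  have e1 : (T : ℂ) * Complex.I + y * Complex.I = ((T + y : ℝ) : ℂ) * Complex.I := by
    push_cast; ring
  have e2 : ((-T : ℝ) : ℂ) * Complex.I - y * Complex.I = ((T + y : ℝ) : ℂ) * -Complex.I := by
    push_cast; ring
  simp only [e1, e2, log_ofReal_mul_I (add_pos hT hy), log_ofReal_mul_neg_I (add_pos hT hy)]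
  split_ifs with h
  · have e3 : (T : ℂ) * Complex.I - y * Complex.I = ((T - y : ℝ) : ℂ) * Complex.I := by
      push_cast; ring
    have e4 : ((-T : ℝ) : ℂ) * Complex.I + y * Complex.I = ((T - y : ℝ) : ℂ) * -Complex.I := by
      push_cast; ring
    rw [e3, e4, log_ofReal_mul_I (sub_pos.2 h), log_ofReal_mul_neg_I (sub_pos.2 h)]
    ring
  · have h' : T < y := lt_of_le_of_ne (not_lt.1 h) hyT.symm
    have e3 : (T : ℂ) * Complex.I - y * Complex.I = ((y - T : ℝ) : ℂ) * -Complex.I := by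
      push_cast; ring
    have e4 : ((-T : ℝ) : ℂ) * Complex.I + y * Complex.I = ((y - T : ℝ) : ℂ) * Complex.I := by
      push_cast; ring
    rw [e3, e4, log_ofReal_mul_I (sub_pos.2 h'), log_ofReal_mul_neg_I (sub_pos.2 h')]
    ring

/-- Linearity of `threeSides`, for functions that are continuous on a set `S` containing the three
sides only: the functions it is used for have poles on the fourth side. -/
lemma threeSides_add_const_mul {ρ T : ℝ} {q g q₁ : ℂ → ℂ} {c : ℂ} {S : Set ℂ}
    (hS : ∀ s ∈ Icc 0 ρ, ∀ b : ℝ, |b| = T → (s : ℂ) + b * Complex.I ∈ S)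
    (hS' : ∀ t ∈ Icc (-T) T, (ρ : ℂ) + (t : ℂ) * Complex.I ∈ S) (hρ : 0 ≤ ρ) (hT : 0 ≤ T)
    (hg : ContinuousOn g S) (hq₁ : ContinuousOn q₁ S) (hq : ∀ w ∈ S, q w = g w + c * q₁ w) :
    threeSides ρ T q = threeSides ρ T g + c * threeSides ρ T q₁ := by
  have key : ∀ (p : ℝ → ℂ) (a b : ℝ), a ≤ b → Continuous p → (∀ t ∈ Icc a b, p t ∈ S) →
      ∫ t in a..b, q (p t) = (∫ t in a..b, g (p t)) + c * ∫ t in a..b, q₁ (p t) := by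
    intro p a b hab hp hpS
    rw [← uIcc_of_le hab] at hpS
    have i1 : IntervalIntegrable (fun t => g (p t)) volume a b :=
      (hg.comp hp.continuousOn hpS).intervalIntegrable
    have i2 : IntervalIntegrable (fun t => q₁ (p t)) volume a b :=
      (hq₁.comp hp.continuousOn hpS).intervalIntegrable
    rw [← intervalIntegral.integral_const_mul, ← intervalIntegral.integral_add i1
      (i2.const_mul c)]
    exact intervalIntegral.integral_congr fun t ht => hq _ (hpS t ht)
  rw [threeSides, threeSides, threeSides,
    key (fun s => s + ((-T : ℝ) : ℂ) * Complex.I) 0 ρ hρ (by fun_prop)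
      (fun s hs => hS s hs (-T) (by rw [abs_neg, abs_of_nonneg hT])),
    key (fun s => s + (T : ℂ) * Complex.I) 0 ρ hρ (by fun_prop)
      (fun s hs => hS s hs T (abs_of_nonneg hT)),
    key (fun t => ρ + t * Complex.I) (-T) T (by linarith) (by fun_prop) hS']
  ring

/-- Cauchy's formula for the part of the region inside the parabola cut off by the image of the
rectangle. The pullback of the difference quotient of `f` is odd, so it integrates to zero along
the side on the imaginary axis. -/
lemma threeSides_cauchy {ρ : ℝ} (hρ : 0 < ρ) {f : ℂ → ℂ}
    (hf : AnalyticOnNhd ℂ f (parabolaInterior ρ ∪ parabola ρ)) {y T : ℝ} (hy : 0 < y)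
    (hT : 0 < T) (hyT : y ≠ T) :
    threeSides ρ T (fun w => 2 * w * f (-w ^ 2) / (w ^ 2 + (y : ℂ) ^ 2)) =
      f ((y : ℂ) ^ 2) * if y < T then 2 * Real.pi * Complex.I else 0 := by
  set A : Set ℂ := {z | AnalyticAt ℂ f z} with hA
  have hAo : IsOpen A := isOpen_analyticAt ℂ f
  have hfA : DifferentiableOn ℂ f A := fun z hz =>
    (show AnalyticAt ℂ f z from hz).differentiableAt.differentiableWithinAt
  have hxA : A ∈ 𝓝 ((y : ℂ) ^ 2) := hAo.mem_nhds (hf _ (ofReal_sq_mem_union hρ y))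
  have hd : DifferentiableOn ℂ (dslope f ((y : ℂ) ^ 2)) A :=
    (Complex.differentiableOn_dslope hxA).2 hfA
  set R : Set ℂ := {w | 0 ≤ w.re ∧ w.re ≤ ρ} with hR
  set g : ℂ → ℂ := fun w => dslope f ((y : ℂ) ^ 2) (-w ^ 2) * (-2 * w) with hg
  have hgR : DifferentiableOn ℂ g R := by
    refine DifferentiableOn.mul ?_ (by fun_prop)
    exact hd.comp (by fun_prop) fun w hw => hf _ (neg_sq_mem_union hw.1 hw.2)
  have hodd : ∫ t in (-T)..T, g (((0 : ℝ) : ℂ) + t * Complex.I) = 0 := by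
    have h1 := intervalIntegral.integral_comp_neg (a := -T) (b := T)
      (fun t : ℝ => g (((0 : ℝ) : ℂ) + t * Complex.I))
    have h2 : ∀ t : ℝ, g (((0 : ℝ) : ℂ) + ((-t : ℝ) : ℂ) * Complex.I) =
        -g (((0 : ℝ) : ℂ) + t * Complex.I) := by
      intro t
      simp [hg]
    simp only [h2, neg_neg, intervalIntegral.integral_neg] at h1
    exact self_eq_neg.1 h1.symm
  have hg0 : threeSides ρ T g = 0 := by
    have h := Complex.integral_boundary_rect_eq_zero_of_differentiableOn g
      (((0 : ℝ) : ℂ) + ((-T : ℝ) : ℂ) * Complex.I) ((ρ : ℂ) + (T : ℂ) * Complex.I)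
      (hgR.mono fun w hw => ?_)
    · simp only [Complex.add_re, Complex.add_im, Complex.mul_re, Complex.mul_im,
        Complex.ofReal_re, Complex.ofReal_im, Complex.I_re, Complex.I_im, mul_zero, mul_one,
        sub_self, add_zero, zero_add, smul_eq_mul] at h
      rw [hodd, mul_zero, sub_zero] at h
      exact h
    · rw [Complex.mem_reProdIm] at hw
      have h1 := hw.1
      simp only [Complex.add_re, Complex.mul_re,
        Complex.ofReal_re, Complex.ofReal_im, Complex.I_re, Complex.I_im, mul_zero, mul_one,
        sub_self, add_zero] at h1
      rwa [uIcc_of_le hρ.le] at h1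
  rw [threeSides_add_const_mul (g := g) (q₁ := fun w => 2 * w / (w ^ 2 + (y : ℂ) ^ 2))
    (c := f ((y : ℂ) ^ 2)) (S := R ∩ {w | 0 < w.re ∨ |w.im| = T})
    (fun s hs b hb => ⟨by simpa [hR] using hs, mem_side_horizontal hb s⟩)
    (fun t _ => ⟨by simpa [hR] using hρ.le, mem_side_vertical hρ t⟩) hρ.le hT.le
    (hgR.continuousOn.mono inter_subset_left)
    ((continuousOn_two_mul_div hy hyT).mono inter_subset_right) ?_, hg0,
    threeSides_two_mul_div hρ hy hT hyT, zero_add]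
  rintro w ⟨-, hw⟩
  have h0 := sq_add_sq_ne_zero' hy hyT hw
  have hne : -w ^ 2 ≠ (y : ℂ) ^ 2 := fun h => h0 (by rw [← h]; ring)
  have h1 : -w ^ 2 - (y : ℂ) ^ 2 ≠ 0 := sub_ne_zero.2 hne
  simp only [hg]
  rw [dslope_of_ne _ hne, slope_def_field]
  rw [show -w ^ 2 - (y : ℂ) ^ 2 = -(w ^ 2 + (y : ℂ) ^ 2) by ring]
  field_simp
  ring

/-! ### Growth of `f` -/

/-- The growth condition in the variable `w = √(-z)`. By continuity it extends to the line
`Re w = ρ`, that is, to the parabola itself. -/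
lemma exists_norm_comp_neg_sq_le {ρ : ℝ} (hρ : 0 < ρ) {f : ℂ → ℂ}
    (hf : AnalyticOnNhd ℂ f (parabolaInterior ρ ∪ parabola ρ)) {K β : ℝ}
    (hgrowth : ∀ᶠ z in Bornology.cobounded ℂ ⊓ 𝓟 (parabolaInterior ρ), ‖f z‖ ≤ K * ‖z‖ ^ β) :
    ∃ R : ℝ, 1 ≤ R ∧ ∀ w : ℂ, 0 ≤ w.re → w.re ≤ ρ → R ≤ ‖w‖ →
      ‖f (-w ^ 2)‖ ≤ |K| * ‖w‖ ^ (2 * β) := by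
  rw [eventually_inf_principal, hasBasis_cobounded_norm.eventually_iff] at hgrowth
  obtain ⟨r, -, hr⟩ := hgrowth
  have hint : ∀ w : ℂ, 0 ≤ w.re → w.re < ρ → max 1 r ≤ ‖w‖ →
      ‖f (-w ^ 2)‖ ≤ |K| * ‖w‖ ^ (2 * β) := by
    intro w h0 h1 hw
    have hw1 : 1 ≤ ‖w‖ := (le_max_left _ _).trans hw
    have hn : ‖-w ^ 2‖ = ‖w‖ ^ 2 := by rw [norm_neg, norm_pow]
    have h2 : r ≤ ‖-w ^ 2‖ := by
      rw [hn]
      exact ((le_max_right _ _).trans hw).trans (le_self_pow₀ hw1 two_ne_zero)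
    have h3 : -w ^ 2 ∈ parabolaInterior ρ := by
      rwa [parabolaInterior, mem_ofPred_eq, sqrtNeg_neg_sq_re h0]
    refine (hr h2 h3).trans ?_
    rw [hn, Real.rpow_mul (norm_nonneg w), Real.rpow_two]
    gcongr
    exact le_abs_self K
  refine ⟨max 1 r + ρ, by linarith [le_max_left 1 r], fun w h0 h1 hw => ?_⟩
  rcases h1.lt_or_eq with h | h
  · exact hint w h0 h (by linarith)
  have hw0 : 0 < ‖w‖ := by linarith [le_max_left 1 r]
  have hfc : ContinuousAt f (-(w - ((0 : ℝ) : ℂ)) ^ 2) := by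
    rw [Complex.ofReal_zero, sub_zero]
    exact (hf _ (neg_sq_mem_union h0 h1)).continuousAt
  have t1 : Tendsto (fun ε : ℝ => ‖f (-(w - (ε : ℂ)) ^ 2)‖) (𝓝[>] 0) (𝓝 ‖f (-w ^ 2)‖) := by
    have : ContinuousAt (fun ε : ℝ => ‖f (-(w - (ε : ℂ)) ^ 2)‖) 0 :=
      (ContinuousAt.comp (f := fun ε : ℝ => -(w - (ε : ℂ)) ^ 2) hfc (by fun_prop)).norm
    simpa using this.tendsto.mono_left nhdsWithin_le_nhds
  have t2 : Tendsto (fun ε : ℝ => |K| * ‖w - (ε : ℂ)‖ ^ (2 * β)) (𝓝[>] 0)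
      (𝓝 (|K| * ‖w‖ ^ (2 * β))) := by
    have : ContinuousAt (fun ε : ℝ => |K| * ‖w - (ε : ℂ)‖ ^ (2 * β)) 0 := by
      refine continuousAt_const.mul (ContinuousAt.rpow_const (by fun_prop) (Or.inl ?_))
      simpa using norm_pos_iff.1 hw0
    simpa using this.tendsto.mono_left nhdsWithin_le_nhds
  refine le_of_tendsto_of_tendsto t1 t2 ?_
  filter_upwards [Ioo_mem_nhdsGT hρ] with ε hε
  have hnorm : ‖w‖ - ε ≤ ‖w - (ε : ℂ)‖ := by
    have := norm_sub_norm_le w (ε : ℂ)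
    rwa [Complex.norm_real, Real.norm_of_nonneg hε.1.le] at this
  refine hint _ ?_ ?_ ?_
  · simp only [Complex.sub_re, Complex.ofReal_re]
    linarith [hε.2]
  · simp only [Complex.sub_re, Complex.ofReal_re]
    linarith [hε.1]
  · linarith [hε.2]

/-- On the positive axis `f` has at most polynomial growth, and `ω_α L_k` has moments of every
order. -/
lemma integrableOn_coeffIntegrand {α : ℝ} (hα : -1 < α) (k : ℕ) {ρ : ℝ} (hρ : 0 < ρ) {f : ℂ → ℂ}
    (hf : AnalyticOnNhd ℂ f (parabolaInterior ρ ∪ parabola ρ)) {K β : ℝ}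
    (hgrowth : ∀ᶠ z in Bornology.cobounded ℂ ⊓ 𝓟 (parabolaInterior ρ), ‖f z‖ ≤ K * ‖z‖ ^ β) :
    IntegrableOn (coeffIntegrand α k f) (Ioi 0) := by
  obtain ⟨R, hR1, hR⟩ := exists_norm_comp_neg_sq_le hρ hf hgrowth
  obtain ⟨N, hN⟩ := exists_nat_ge β
  have hsqrt : ∀ x : ℝ, 0 ≤ x → (x : ℂ) = -(√x * Complex.I) ^ 2 := by
    intro x hx
    rw [mul_pow, Complex.I_sq, ← Complex.ofReal_pow, Real.sq_sqrt hx]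
    ring
  have hcont : ContinuousOn (fun x : ℝ => f x) (Ici 0) := by
    intro x hx
    have hmem : (x : ℂ) ∈ parabolaInterior ρ ∪ parabola ρ := by
      have := ofReal_sq_mem_union hρ (√x)
      rwa [← Complex.ofReal_pow, Real.sq_sqrt hx] at this
    exact (ContinuousAt.comp (f := fun x : ℝ => (x : ℂ)) (hf _ hmem).continuousAt
      (by fun_prop)).continuousWithinAt
  obtain ⟨M, hM⟩ := isCompact_Icc.exists_bound_of_continuousOn
    (hcont.mono (Icc_subset_Ici_self : Icc 0 (R ^ 2) ⊆ Ici 0))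
  have hM0 : 0 ≤ M := (norm_nonneg _).trans (hM 0 ⟨le_rfl, by positivity⟩)
  have hbound : ∀ x : ℝ, 0 < x → ‖f x‖ ≤ M + |K| * x ^ N := by
    intro x hx
    rcases le_total x (R ^ 2) with h | h
    · have := hM x ⟨hx.le, h⟩
      have : 0 ≤ |K| * x ^ N := by positivity
      linarith
    · have hs : R ≤ √x := Real.le_sqrt_of_sq_le h
      have hn : ‖(√x * Complex.I : ℂ)‖ = √x := by
        rw [norm_mul, Complex.norm_I, mul_one, Complex.norm_real,
          Real.norm_of_nonneg (Real.sqrt_nonneg x)]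
      have h1 := hR (√x * Complex.I) (by simp) (by simpa using hρ.le) (by rwa [hn])
      rw [← hsqrt x hx.le, hn, Real.rpow_mul (Real.sqrt_nonneg x), Real.rpow_two,
        Real.sq_sqrt hx.le] at h1
      have hx1 : 1 ≤ x := (one_le_pow₀ hR1).trans h
      have h2 : x ^ β ≤ x ^ N := by
        rw [← Real.rpow_natCast]
        exact Real.rpow_le_rpow_of_exponent_le hx1 hN
      have := mul_le_mul_of_nonneg_left h2 (abs_nonneg K)
      linarith
  have hi := fun m => (integrableOn_pow_mul_weight_mul_laguerreL hα k m).norm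
  refine (((hi 0).const_mul M).add ((hi N).const_mul |K|)).mono' ?_ ?_
  · have h1 := (hcont.mono Ioi_subset_Ici_self).aestronglyMeasurable
      (μ := volume) measurableSet_Ioi
    have h2 := (continuous_laguerreL α k).measurable
    have h3 := measurable_weight α
    unfold coeffIntegrand
    exact (h1.mul (by fun_prop)).mul (by fun_prop)
  · filter_upwards [ae_restrict_mem measurableSet_Ioi] with x hx
    have hx : 0 < x := hx
    rw [coeffIntegrand, norm_mul, norm_mul, Complex.norm_real, Complex.norm_real]
    simp only [Pi.add_apply, norm_mul, pow_zero, one_mul, norm_pow]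
    rw [Real.norm_of_nonneg hx.le]
    calc _ ≤ (M + |K| * x ^ N) * ‖laguerreL α k x‖ * ‖weight α x‖ := by
          gcongr
          exact hbound x hx
      _ = _ := by ring

/-! ### Interchanging the contour integral with the Cauchy transform -/

/-- Fubini for the kernel `1 / (w² + y²)`, with `w = p t` on a side of the contour, under a product
bound `b₁ t * b₂ y`. The bound is asked for almost every `y`, since a horizontal side meets the
imaginary axis in a zero of `w² + y²` for one value of `y`. -/
lemma intervalIntegral_mul_integral_swap {α : ℝ} {k : ℕ} {F p : ℝ → ℂ} {a b : ℝ} (hab : a ≤ b)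
    (hF : ContinuousOn F (Icc a b)) (hp : Continuous p) {b₁ b₂ : ℝ → ℝ}
    (h₁ : IntegrableOn b₁ (Ioc a b))
    (h₂ : IntegrableOn (fun y => |sqrtDensity α k y| * b₂ y) (Ioi 0))
    (hb : ∀ᵐ y : ℝ ∂(volume.restrict (Ioi 0)), ∀ t ∈ Ioc a b,
      ‖F t / (p t ^ 2 + (y : ℂ) ^ 2)‖ ≤ b₁ t * b₂ y) :
    IntegrableOn (fun y : ℝ => (sqrtDensity α k y : ℂ) *
      ∫ t in a..b, F t / (p t ^ 2 + (y : ℂ) ^ 2)) (Ioi 0) ∧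
    ∫ t in a..b, F t * ∫ y in Ioi (0 : ℝ), (sqrtDensity α k y : ℂ) / (p t ^ 2 + (y : ℂ) ^ 2) =
      ∫ y in Ioi (0 : ℝ), (sqrtDensity α k y : ℂ) *
        ∫ t in a..b, F t / (p t ^ 2 + (y : ℂ) ^ 2) := by
  have hHm := measurable_sqrtDensity α k
  have hprod : Integrable (Function.uncurry fun (t y : ℝ) =>
      (sqrtDensity α k y : ℂ) * (F t / (p t ^ 2 + (y : ℂ) ^ 2)))
      ((volume.restrict (Ioc a b)).prod (volume.restrict (Ioi 0))) := by
    refine (h₁.mul_prod h₂).mono' ?_ ?_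
    · have hF' : AEStronglyMeasurable F (volume.restrict (Ioc a b)) :=
        (hF.mono Ioc_subset_Icc_self).aestronglyMeasurable measurableSet_Ioc
      have hk : Measurable fun z : ℝ × ℝ => (p z.1 ^ 2 + (z.2 : ℂ) ^ 2)⁻¹ := by
        have := hp.measurable
        fun_prop
      have hH : Measurable fun z : ℝ × ℝ => (sqrtDensity α k z.2 : ℂ) := by fun_prop
      exact hH.aestronglyMeasurable.mul (hF'.comp_fst.mul hk.aestronglyMeasurable)
    · have m1 : ∀ᵐ z : ℝ × ℝ ∂((volume.restrict (Ioc a b)).prod (volume.restrict (Ioi 0))),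
          z.1 ∈ Ioc a b :=
        Measure.quasiMeasurePreserving_fst.ae (ae_restrict_mem measurableSet_Ioc)
      filter_upwards [m1, Measure.quasiMeasurePreserving_snd.ae hb] with z hz1 hz2
      simp only [Function.uncurry]
      rw [norm_mul, Complex.norm_real, Real.norm_eq_abs, mul_left_comm]
      exact mul_le_mul_of_nonneg_left (hz2 z.1 hz1) (abs_nonneg _)
  have e1 : ∀ y : ℝ, (sqrtDensity α k y : ℂ) * ∫ t in a..b, F t / (p t ^ 2 + (y : ℂ) ^ 2) =
      ∫ t in Ioc a b, (sqrtDensity α k y : ℂ) * (F t / (p t ^ 2 + (y : ℂ) ^ 2)) := fun y => by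
    rw [intervalIntegral.integral_of_le hab, integral_const_mul]
  simp only [e1]
  refine ⟨hprod.integral_prod_right, ?_⟩
  rw [← integral_integral_swap hprod, intervalIntegral.integral_of_le hab]
  refine integral_congr_ae (ae_of_all _ fun t => ?_)
  simp only [← integral_const_mul]
  refine integral_congr_ae (ae_of_all _ fun y => ?_)
  simp only
  ring

lemma integrableOn_abs_sqrtDensity_mul_inv_sqrt {α : ℝ} (hα : -1 < α) (k : ℕ) {T : ℝ}
    (hT : 0 < T) :
    IntegrableOn (fun y => |sqrtDensity α k y| * (√|T - y|)⁻¹) (Ioi 0) := by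
  have hHm := measurable_sqrtDensity α k
  obtain ⟨B, hB⟩ := exists_abs_pow_mul_sqrtDensity_le hα k 0
  have hVi := (integrableOn_pow_mul_sqrtDensity hα k (0 + 1)).norm
  have hVm : Measurable fun y => ‖(y ^ 2) ^ (0 + 1) * sqrtDensity α k y‖ :=
    (by fun_prop : Measurable fun y => (y ^ 2) ^ (0 + 1) * sqrtDensity α k y).norm
  obtain ⟨C, hC⟩ := exists_integral_mul_inv_sqrt_abs_le hVi hVm (fun y _ => norm_nonneg _) hB
  refine (((integrableOn_sqrtDensity hα k).norm.const_mul (√(T / 2))⁻¹).add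
    ((hC T).1.const_mul (4 / T ^ 2))).mono' (by fun_prop) ?_
  filter_upwards [ae_restrict_mem measurableSet_Ioi] with y hy
  have hy : 0 < y := hy
  rw [Real.norm_of_nonneg (by positivity)]
  -- The density may be unbounded near `0`, where the kernel is bounded; away from `0` it is
  -- dominated by a multiple of `y²` times itself, which is bounded.
  simp only [Pi.add_apply, zero_add, pow_one, norm_mul, Real.norm_eq_abs, abs_pow, abs_of_pos hy]
  rcases le_total y (T / 2) with h | h
  · have h1 : (√|T - y|)⁻¹ ≤ (√(T / 2))⁻¹ := by
      refine inv_anti₀ (Real.sqrt_pos.2 (by linarith)) (Real.sqrt_le_sqrt ?_)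
      rw [abs_of_nonneg (by linarith)]
      linarith
    have h2 := mul_le_mul_of_nonneg_left h1 (abs_nonneg (sqrtDensity α k y))
    have h3 : 0 ≤ 4 / T ^ 2 * (y ^ 2 * |sqrtDensity α k y| * (√|T - y|)⁻¹) := by positivity
    linarith
  · have h1 : 1 ≤ 4 / T ^ 2 * y ^ 2 := by
      rw [div_mul_eq_mul_div, one_le_div (by positivity)]
      nlinarith
    have h2 : 0 ≤ |sqrtDensity α k y| * (√|T - y|)⁻¹ := by positivity
    have h3 : 0 ≤ (√(T / 2))⁻¹ * |sqrtDensity α k y| := by positivity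
    have h4 := le_mul_of_one_le_left h2 h1
    calc _ ≤ _ := h4
      _ = 4 / T ^ 2 * (y ^ 2 * |sqrtDensity α k y| * (√|T - y|)⁻¹) := by ring
      _ ≤ _ := le_add_of_nonneg_left h3

/-! ### The contour integral of the Cauchy transform -/

/-- The pullback of the differential form `Φ_k(z) f(z) dz` under `z = -w²`. -/
noncomputable def stripForm (α : ℝ) (k : ℕ) (f : ℂ → ℂ) (w : ℂ) : ℂ :=
  cauchyPhi α k (-w ^ 2) * f (-w ^ 2) * (-2 * w)

lemma stripForm_eq (α : ℝ) (k : ℕ) (f : ℂ → ℂ) (w : ℂ) :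
    stripForm α k f w = 1 / (2 * (Real.pi : ℂ) * Complex.I) * (2 * w * f (-w ^ 2) *
      ∫ y in Ioi (0 : ℝ), (sqrtDensity α k y : ℂ) / (w ^ 2 + (y : ℂ) ^ 2)) := by
  rw [stripForm, cauchyPhi_neg_sq]
  ring

lemma pullback_eq_stripForm (α : ℝ) (k : ℕ) (ρ : ℝ) (f : ℂ → ℂ) (t : ℝ) :
    pullback ρ (fun z => cauchyPhi α k z * f z) t =
      Complex.I * stripForm α k f (ρ + t * Complex.I) := by
  have h1 : HasDerivAt (fun t : ℝ => (ρ : ℂ) + t * Complex.I) (1 * Complex.I) t :=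
    (Complex.ofRealCLM.hasDerivAt.mul_const _).const_add _
  have h2 : HasDerivAt (parabolaPath ρ) _ t := (h1.pow 2).neg
  rw [pullback, h2.deriv, parabolaPath, stripForm]
  push_cast
  ring

lemma continuousOn_two_mul_comp_neg_sq {ρ : ℝ} {f : ℂ → ℂ}
    (hf : AnalyticOnNhd ℂ f (parabolaInterior ρ ∪ parabola ρ)) {p : ℝ → ℂ} (hp : Continuous p)
    {S : Set ℝ} (hS : ∀ t ∈ S, 0 ≤ (p t).re ∧ (p t).re ≤ ρ) :
    ContinuousOn (fun t => 2 * p t * f (-p t ^ 2)) S := by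
  refine ContinuousOn.mul (by fun_prop) ?_
  exact hf.continuousOn.comp (by fun_prop) fun t ht => neg_sq_mem_union (hS t ht).1 (hS t ht).2

lemma continuous_pullback {α : ℝ} (hα : -1 < α) (k : ℕ) {ρ : ℝ} (hρ : 0 < ρ) {f : ℂ → ℂ}
    (hf : AnalyticOnNhd ℂ f (parabolaInterior ρ ∪ parabola ρ)) :
    Continuous (pullback ρ fun z => cauchyPhi α k z * f z) := by
  have hp : Continuous fun t : ℝ => (ρ : ℂ) + t * Complex.I := by fun_prop
  have h1 := continuous_cauchyPhi_neg_sq hα k hρ hp (fun t => by simp)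
  have h2 := continuousOn_univ.1 (continuousOn_two_mul_comp_neg_sq hf hp (S := univ)
    fun t _ => by simpa using hρ.le)
  have h3 : Continuous fun t : ℝ => -Complex.I * (cauchyPhi α k (-(ρ + t * Complex.I) ^ 2) *
      (2 * (ρ + t * Complex.I) * f (-(ρ + t * Complex.I) ^ 2))) :=
    continuous_const.mul (h1.mul h2)
  refine h3.congr fun t => ?_
  rw [pullback_eq_stripForm, stripForm]
  ring

/-- Fubini on a horizontal side. The kernel is singular where the side meets the imaginary axis;
it is dominated by a product of two integrable inverse square roots. -/
lemma integral_horizontal_stripForm {α : ℝ} (hα : -1 < α) (k : ℕ) {ρ : ℝ} (hρ : 0 < ρ)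
    {f : ℂ → ℂ} (hf : AnalyticOnNhd ℂ f (parabolaInterior ρ ∪ parabola ρ)) {b T : ℝ}
    (hT : 0 < T) (hb : |b| = T) :
    IntegrableOn (fun y : ℝ => (sqrtDensity α k y : ℂ) * ∫ s in (0 : ℝ)..ρ,
      (fun w => 2 * w * f (-w ^ 2) / (w ^ 2 + (y : ℂ) ^ 2)) (s + (b : ℂ) * Complex.I)) (Ioi 0) ∧
    ∫ s in (0 : ℝ)..ρ, stripForm α k f (s + (b : ℂ) * Complex.I) =
      1 / (2 * (Real.pi : ℂ) * Complex.I) * ∫ y in Ioi (0 : ℝ),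
        (sqrtDensity α k y : ℂ) * ∫ s in (0 : ℝ)..ρ,
          (fun w => 2 * w * f (-w ^ 2) / (w ^ 2 + (y : ℂ) ^ 2)) (s + (b : ℂ) * Complex.I) := by
  have hp : Continuous fun s : ℝ => (s : ℂ) + (b : ℂ) * Complex.I := by fun_prop
  have hF := continuousOn_two_mul_comp_neg_sq hf hp (S := Icc 0 ρ) fun t ht => by simpa using ht
  obtain ⟨M, hM⟩ := isCompact_Icc.exists_bound_of_continuousOn hF
  have hb1 : IntegrableOn (fun s : ℝ => M * T⁻¹ * (√s)⁻¹) (Ioc 0 ρ) :=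
    Integrable.const_mul ((intervalIntegrable_iff_integrableOn_Ioc_of_le hρ.le).1
      (intervalIntegrable_inv_sqrt hρ.le)) _
  have h := intervalIntegral_mul_integral_swap (α := α) (k := k) hρ.le hF hp hb1
    (integrableOn_abs_sqrtDensity_mul_inv_sqrt hα k hT) ?_
  · simp only [stripForm_eq, intervalIntegral.integral_const_mul]
    exact ⟨h.1, by rw [h.2]⟩
  · have hne : ∀ᵐ y ∂(volume.restrict (Ioi (0 : ℝ))), y ≠ T :=
      ae_restrict_of_ae (by simp [ae_iff, measure_singleton])
    filter_upwards [ae_restrict_mem measurableSet_Ioi, hne] with y hy hyT s hs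
    have hk := le_norm_sq_add_sq ((s : ℂ) + (b : ℂ) * Complex.I) (le_of_lt hy)
    simp only [Complex.add_re, Complex.add_im, Complex.mul_re, Complex.mul_im,
        Complex.ofReal_re, Complex.ofReal_im, Complex.I_re, Complex.I_im, mul_zero, mul_one,
        sub_self, add_zero, zero_add, hb] at hk
    have hpos : 0 < T * (√s * √|T - y|) :=
      mul_pos hT (mul_pos (Real.sqrt_pos.2 hs.1)
        (Real.sqrt_pos.2 (abs_pos.2 (sub_ne_zero.2 hyT.symm))))
    have hMs := hM s ⟨hs.1.le, hs.2⟩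
    rw [norm_div]
    calc _ ≤ M / (T * (√s * √|T - y|)) :=
          div_le_div₀ ((norm_nonneg _).trans hMs) hMs hpos hk
      _ = _ := by rw [div_eq_mul_inv, mul_inv, mul_inv]; ring

lemma integral_vertical_stripForm {α : ℝ} (hα : -1 < α) (k : ℕ) {ρ : ℝ} (hρ : 0 < ρ)
    {f : ℂ → ℂ} (hf : AnalyticOnNhd ℂ f (parabolaInterior ρ ∪ parabola ρ)) {T : ℝ}
    (hT : 0 < T) :
    IntegrableOn (fun y : ℝ => (sqrtDensity α k y : ℂ) * ∫ t in (-T)..T,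
      (fun w => 2 * w * f (-w ^ 2) / (w ^ 2 + (y : ℂ) ^ 2)) (ρ + t * Complex.I)) (Ioi 0) ∧
    ∫ t in (-T)..T, stripForm α k f (ρ + t * Complex.I) =
      1 / (2 * (Real.pi : ℂ) * Complex.I) * ∫ y in Ioi (0 : ℝ),
        (sqrtDensity α k y : ℂ) * ∫ t in (-T)..T,
          (fun w => 2 * w * f (-w ^ 2) / (w ^ 2 + (y : ℂ) ^ 2)) (ρ + t * Complex.I) := by
  have hp : Continuous fun t : ℝ => (ρ : ℂ) + t * Complex.I := by fun_prop
  have hF := continuousOn_two_mul_comp_neg_sq hf hp (S := Icc (-T) T)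
    fun t _ => by simpa using hρ.le
  obtain ⟨M, hM⟩ := isCompact_Icc.exists_bound_of_continuousOn hF
  have h := intervalIntegral_mul_integral_swap (α := α) (k := k) (by linarith : -T ≤ T) hF hp
    (b₁ := fun _ => M / ρ ^ 2) (b₂ := fun _ => 1) (by simp)
    (by simpa [IntegrableOn] using (integrableOn_sqrtDensity hα k).norm) ?_
  · simp only [stripForm_eq, intervalIntegral.integral_const_mul]
    exact ⟨h.1, by rw [h.2]⟩
  · refine ae_of_all _ fun y t ht => ?_
    have hk := re_sq_le_norm_sq_add_sq (w := (ρ : ℂ) + t * Complex.I) (by simpa using hρ.le) y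
    have hMs := hM t ⟨ht.1.le, ht.2⟩
    rw [norm_div, mul_one]
    refine div_le_div₀ ((norm_nonneg _).trans hMs) hMs (by positivity) ?_
    simpa using hk

/-- Cauchy's formula integrated against the weight: the truncated contour integral recovers the
part of the inner product over `x = y² < T²`. -/
lemma threeSides_stripForm {α : ℝ} (hα : -1 < α) (k : ℕ) {ρ : ℝ} (hρ : 0 < ρ) {f : ℂ → ℂ}
    (hf : AnalyticOnNhd ℂ f (parabolaInterior ρ ∪ parabola ρ)) {T : ℝ} (hT : 0 < T) :
    threeSides ρ T (stripForm α k f) =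
      ∫ y in Iio T, (sqrtDensity α k y : ℂ) * f ((y : ℂ) ^ 2) ∂(volume.restrict (Ioi 0)) := by
  obtain ⟨i1, e1⟩ := integral_horizontal_stripForm hα k hρ hf hT (b := -T)
    (by rw [abs_neg, abs_of_pos hT])
  obtain ⟨i2, e2⟩ := integral_horizontal_stripForm hα k hρ hf hT (abs_of_pos hT)
  obtain ⟨i3, e3⟩ := integral_vertical_stripForm hα k hρ hf hT
  rw [threeSides, e1, e2, e3, ← mul_sub, mul_left_comm, ← mul_add, ← integral_sub' i1 i2,
    ← integral_const_mul, ← integral_add (i1.sub i2) (i3.const_mul _), ← integral_const_mul,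
    ← integral_indicator measurableSet_Iio]
  have hne : ∀ᵐ y ∂(volume.restrict (Ioi (0 : ℝ))), y ≠ T :=
    ae_restrict_of_ae (by simp [ae_iff, measure_singleton])
  refine integral_congr_ae ?_
  filter_upwards [ae_restrict_mem measurableSet_Ioi, hne] with y hy hyT
  have h := threeSides_cauchy hρ hf hy hT hyT
  rw [threeSides] at h
  simp only [Pi.sub_apply]
  rw [← mul_sub, mul_left_comm, ← mul_add, h]
  have hpi : (2 * (Real.pi : ℂ) * Complex.I) ≠ 0 := Complex.two_pi_I_ne_zero
  by_cases hlt : y < T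
  · rw [indicator_of_mem (mem_Iio.2 hlt), if_pos hlt]
    field_simp
  · rw [indicator_of_notMem (by simpa using hlt), if_neg hlt]
    simp

/-- The form decays like `|Im w|^{2β - 2k - 1}` in the strip, with an integrable singularity at
the imaginary axis. -/
lemma exists_norm_stripForm_le {α : ℝ} (hα : -1 < α) (k : ℕ) {ρ : ℝ} (hρ : 0 < ρ) {f : ℂ → ℂ}
    (hf : AnalyticOnNhd ℂ f (parabolaInterior ρ ∪ parabola ρ)) {K β : ℝ}
    (hgrowth : ∀ᶠ z in Bornology.cobounded ℂ ⊓ 𝓟 (parabolaInterior ρ), ‖f z‖ ≤ K * ‖z‖ ^ β)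
    (hβ : β - 1 / 2 < k) :
    ∃ C R : ℝ, 0 ≤ C ∧ 1 ≤ R ∧ ∀ w : ℂ, 0 < w.re → w.re ≤ ρ → R ≤ |w.im| →
      ‖stripForm α k f w‖ ≤ C * |w.im| ^ (2 * β - 2 * k - 1) * (1 + (√w.re)⁻¹) := by
  obtain ⟨C, hC0, hC⟩ := exists_norm_cauchyPhi_neg_sq_le hα k
  obtain ⟨R, hR1, hR⟩ := exists_norm_comp_neg_sq_le hρ hf hgrowth
  refine ⟨2 * C * |K|, R, by positivity, hR1, fun w h0 h1 him => ?_⟩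
  have hw : |w.im| ≤ ‖w‖ := Complex.abs_im_le_norm w
  have him1 : 1 ≤ |w.im| := hR1.trans him
  have hw0 : 0 < ‖w‖ := by linarith
  have hΦ : ‖cauchyPhi α k (-w ^ 2)‖ ≤ C * (1 + (√w.re)⁻¹) * ‖w‖ ^ (-(2 * k + 2) : ℝ) := by
    rw [Real.rpow_neg hw0.le, ← div_eq_mul_inv, le_div_iff₀ (by positivity)]
    have := hC w h0 him1
    rw [← Real.rpow_natCast] at this
    push_cast at this
    rwa [mul_add, mul_one] at this
  have hff := hR w h0.le h1 (him.trans hw)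
  have h2w : ‖-2 * w‖ = 2 * ‖w‖ := by rw [norm_mul, norm_neg, Complex.norm_ofNat]
  have hs : 0 ≤ (√w.re)⁻¹ := by positivity
  rw [stripForm, norm_mul, norm_mul, h2w]
  calc _ ≤ (C * (1 + (√w.re)⁻¹) * ‖w‖ ^ (-(2 * k + 2) : ℝ)) * (|K| * ‖w‖ ^ (2 * β)) *
        (2 * ‖w‖) := by gcongr
    _ = 2 * C * |K| * (1 + (√w.re)⁻¹) *
        (‖w‖ ^ (-(2 * k + 2) : ℝ) * ‖w‖ ^ (2 * β) * ‖w‖ ^ (1 : ℝ)) := by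
        rw [Real.rpow_one]; ring
    _ = 2 * C * |K| * (1 + (√w.re)⁻¹) * ‖w‖ ^ (2 * β - 2 * k - 1) := by
        rw [← Real.rpow_add hw0, ← Real.rpow_add hw0]
        congr 2
        ring
    _ ≤ 2 * C * |K| * (1 + (√w.re)⁻¹) * |w.im| ^ (2 * β - 2 * k - 1) := by
        gcongr 2 * C * |K| * (1 + (√w.re)⁻¹) * ?_
        exact Real.rpow_le_rpow_of_nonpos (by linarith) hw (by linarith)
    _ = _ := by ring

/-- Along a horizontal side the form is `O(T^{2β - 2k - 1})` up to an integrable factor, and the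
exponent is negative because `β - 1/2 < k`. -/
lemma tendsto_integral_horizontal_stripForm {α : ℝ} (hα : -1 < α) (k : ℕ) {ρ : ℝ} (hρ : 0 < ρ)
    {f : ℂ → ℂ} (hf : AnalyticOnNhd ℂ f (parabolaInterior ρ ∪ parabola ρ)) {K β : ℝ}
    (hgrowth : ∀ᶠ z in Bornology.cobounded ℂ ⊓ 𝓟 (parabolaInterior ρ), ‖f z‖ ≤ K * ‖z‖ ^ β)
    (hβ : β - 1 / 2 < k) {b : ℝ → ℝ} (hb : ∀ T, 0 < T → |b T| = T) :
    Tendsto (fun T => ∫ s in (0 : ℝ)..ρ, stripForm α k f (s + (b T : ℂ) * Complex.I)) atTop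
      (𝓝 0) := by
  obtain ⟨C, R, hC0, hR1, hC⟩ := exists_norm_stripForm_le hα k hρ hf hgrowth hβ
  have hi : IntervalIntegrable (fun s : ℝ => 1 + (√s)⁻¹) volume 0 ρ :=
    intervalIntegrable_const.add (intervalIntegrable_inv_sqrt hρ.le)
  have hlim : Tendsto (fun T : ℝ => C * T ^ (2 * β - 2 * k - 1) * ∫ s in (0 : ℝ)..ρ,
      (1 + (√s)⁻¹)) atTop (𝓝 0) := by
    have := tendsto_rpow_neg_atTop (y := -(2 * β - 2 * k - 1)) (by linarith)
    rw [neg_neg] at this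
    simpa using (this.const_mul C).mul_const (∫ s in (0 : ℝ)..ρ, (1 + (√s)⁻¹))
  refine squeeze_zero_norm' ?_ hlim
  filter_upwards [eventually_ge_atTop R] with T hT
  rw [← intervalIntegral.integral_const_mul]
  refine intervalIntegral.norm_integral_le_of_norm_le hρ.le (ae_of_all _ fun s hs => ?_)
    (hi.const_mul _)
  have hbT := hb T (by linarith)
  have h := hC (s + (b T : ℂ) * Complex.I) (by simpa using hs.1) (by simpa using hs.2)
    (by simpa [hbT] using hT)
  simpa [hbT] using h

/-- On the line `Re w = ρ` the form is `O(|t|^{2β - 2k - 1})`, which is integrable as soon as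
`β < k`. -/
lemma integrable_pullback {α : ℝ} (hα : -1 < α) (k : ℕ) {ρ : ℝ} (hρ : 0 < ρ) {f : ℂ → ℂ}
    (hf : AnalyticOnNhd ℂ f (parabolaInterior ρ ∪ parabola ρ)) {K β : ℝ}
    (hgrowth : ∀ᶠ z in Bornology.cobounded ℂ ⊓ 𝓟 (parabolaInterior ρ), ‖f z‖ ≤ K * ‖z‖ ^ β)
    (hβ : β < k) : Integrable (pullback ρ fun z => cauchyPhi α k z * f z) := by
  obtain ⟨C, R, hC0, hR1, hC⟩ := exists_norm_stripForm_le hα k hρ hf hgrowth (by linarith)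
  set e : ℝ := 2 * β - 2 * k - 1 with he
  have hg : Integrable fun t : ℝ => (1 + ‖t‖) ^ (-(-e)) :=
    integrable_one_add_norm (by rw [Module.finrank_self]; push_cast; linarith)
  rw [neg_neg] at hg
  refine (continuous_pullback hα k hρ hf).locallyIntegrable.integrable_of_isBigO_cocompact
    (g := fun t : ℝ => (1 + ‖t‖) ^ e) ?_ (hg.integrableAtFilter _)
  refine Asymptotics.IsBigO.of_bound (C * (1 + (√ρ)⁻¹) * 2 ^ (-e)) ?_
  filter_upwards [tendsto_norm_cocompact_atTop.eventually_ge_atTop R] with t ht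
  have ht1 : 1 ≤ |t| := hR1.trans ht
  have h := hC (ρ + t * Complex.I) (by simpa using hρ) (by simp) (by simpa using ht)
  simp only [Complex.add_re, Complex.add_im, Complex.mul_re, Complex.mul_im,
    Complex.ofReal_re, Complex.ofReal_im, Complex.I_re, Complex.I_im, mul_zero, mul_one,
    sub_self, add_zero, zero_add] at h
  have hpow : |t| ^ e ≤ 2 ^ (-e) * (1 + |t|) ^ e := by
    have h1 : (2 * |t|) ^ e ≤ (1 + |t|) ^ e :=
      Real.rpow_le_rpow_of_nonpos (by positivity) (by linarith) (by linarith)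
    rw [Real.mul_rpow two_pos.le (abs_nonneg t)] at h1
    rw [Real.rpow_neg two_pos.le, ← div_eq_inv_mul, le_div_iff₀ (by positivity)]
    linarith
  rw [pullback_eq_stripForm, norm_mul, Complex.norm_I, one_mul,
    Real.norm_of_nonneg (by positivity), Real.norm_eq_abs]
  have h2 : 0 ≤ (√ρ)⁻¹ := by positivity
  calc _ ≤ _ := h
    _ ≤ C * (2 ^ (-e) * (1 + |t|) ^ e) * (1 + (√ρ)⁻¹) := by gcongr
    _ = _ := by ring

lemma hasParabolaIntegral_cauchyPhi_mul {α : ℝ} (hα : -1 < α) (k : ℕ) {ρ : ℝ} (hρ : 0 < ρ)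
    {f : ℂ → ℂ} (hf : AnalyticOnNhd ℂ f (parabolaInterior ρ ∪ parabola ρ)) {K β : ℝ}
    (hgrowth : ∀ᶠ z in Bornology.cobounded ℂ ⊓ 𝓟 (parabolaInterior ρ), ‖f z‖ ≤ K * ‖z‖ ^ β)
    (hβ : β - 1 / 2 < k) :
    HasParabolaIntegral ρ (fun z => cauchyPhi α k z * f z)
      (∫ x in Ici (0 : ℝ), coeffIntegrand α k f x) := by
  refine ⟨fun T => (continuous_pullback hα k hρ hf).intervalIntegrable _ _, ?_⟩
  have hcoeff : ∀ y : ℝ, ((2 * y : ℝ) : ℂ) * coeffIntegrand α k f (y ^ 2) =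
      (sqrtDensity α k y : ℂ) * f ((y : ℂ) ^ 2) := by
    intro y
    rw [coeffIntegrand, sqrtDensity]
    push_cast
    ring
  have hI : ∫ x in Ici (0 : ℝ), coeffIntegrand α k f x =
      ∫ y in Ioi (0 : ℝ), (sqrtDensity α k y : ℂ) * f ((y : ℂ) ^ 2) := by
    rw [integral_Ici_eq_integral_Ioi, integral_Ioi_eq_integral_comp_sq]
    simp only [hcoeff]
  have hi : IntegrableOn (fun y : ℝ => (sqrtDensity α k y : ℂ) * f ((y : ℂ) ^ 2)) (Ioi 0) := by
    refine (integrableOn_comp_sq (integrableOn_coeffIntegrand hα k hρ hf hgrowth)).congr_fun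
      (fun y _ => ?_) measurableSet_Ioi
    simp only
    rw [← hcoeff, Complex.real_smul]
  have t1 := (aecover_Iio (μ := volume.restrict (Ioi (0 : ℝ)))
    tendsto_id).integral_tendsto_of_countably_generated hi
  have t2 := tendsto_integral_horizontal_stripForm hα k hρ hf hgrowth hβ (b := fun T => -T)
    fun T hT => by rw [abs_neg, abs_of_pos hT]
  have t3 := tendsto_integral_horizontal_stripForm hα k hρ hf hgrowth hβ (b := fun T => T)
    fun T hT => abs_of_pos hT
  have t := (t1.sub t2).add t3
  rw [sub_zero, add_zero, ← hI] at t
  refine t.congr' ?_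
  filter_upwards [eventually_gt_atTop 0] with T hT
  simp only [pullback_eq_stripForm, intervalIntegral.integral_const_mul, id]
  rw [← threeSides_stripForm hα k hρ hf hT, threeSides]
  ring

end LaguerreParabola

theorem theorem3p1 (α : ℝ) (hα : -1 < α) (ρ : ℝ) (hρ : 0 < ρ) (f : ℂ → ℂ)
    (hf : AnalyticOnNhd ℂ f
      (LaguerreParabola.parabolaInterior ρ ∪ LaguerreParabola.parabola ρ))
    (K β : ℝ)
    (hgrowth : ∀ᶠ z in Bornology.cobounded ℂ ⊓ 𝓟 (LaguerreParabola.parabolaInterior ρ),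
      ‖f z‖ ≤ K * ‖z‖ ^ β)
    (k : ℕ) (hk : max (⌊β - 1 / 2⌋ + 1) 0 ≤ (k : ℤ)) :
    IntegrableOn (LaguerreParabola.coeffIntegrand α k f) (Ici (0 : ℝ)) ∧
    (∃ I : ℂ,
      LaguerreParabola.HasParabolaIntegral ρ
        (fun z => LaguerreParabola.cauchyPhi α k z * f z) I ∧
      LaguerreParabola.laguerreCoeff α k f
        = 1 / (LaguerreParabola.gammaCoeff α k : ℂ) * I) ∧
    (β < k → Integrable (LaguerreParabola.pullback ρ
      (fun z => LaguerreParabola.cauchyPhi α k z * f z))) := by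
  have hβ : β - 1 / 2 < k := by
    have h1 : ⌊β - 1 / 2⌋ < (k : ℤ) := Int.lt_of_add_one_le ((le_max_left _ _).trans hk)
    exact_mod_cast Int.floor_lt.1 h1
  refine ⟨?_, ⟨_, LaguerreParabola.hasParabolaIntegral_cauchyPhi_mul hα k hρ hf hgrowth hβ, ?_⟩,
    fun h => LaguerreParabola.integrable_pullback hα k hρ hf hgrowth h⟩
  · rw [integrableOn_Ici_iff_integrableOn_Ioi]
    exact LaguerreParabola.integrableOn_coeffIntegrand hα k hρ hf hgrowth
  · rw [LaguerreParabola.laguerreCoeff, div_eq_mul_inv, one_div, mul_comm]
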